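/- A polyhedron is a connected subset $\mathcal P$ of $\mathbb R^3$ that is a union of finitely many closed (non-degenerate) tetrahedra and whose boundary is a (possibly non-connected) orientable 2-manifold. A face of $\mathcal P$ is a maximal planar region contained in the boundary of $\mathcal P$, i.e. a maximal two-dimensional planar subset of the boundary that has connected, non-empty relative interior and is contained in the closure of its relative interior; the corresponding open face is the relative interior of the face. $\mathcal P$ is $4$-oriented if there are four unit vectors such that each face is orthogonal to one of them. Two points see each other if no point of the segment joining them lies in the exterior of $\mathcal P$, and a set $G$ of faces is a set of open face guards for $\mathcal P$ if the set of points that are seen by at least one point of at least one of the corresponding open faces is all of $\mathcal P$ (including its boundary). Theorem. $\lfloor f/4\rfloor$ open face guards are always sufficient and sometimes necessary to guard a $4$-oriented polyhedron with $f$ faces. That is: (1) every $4$-oriented polyhedron with exactly $f$ faces is guarded by some set of at most $\lfloor f/4\rfloor$ open face guards; (2) for every integer $f\geqslant 4$ there is a $4$-oriented polyhedron with exactly $f$ faces such that every set of open face guards that guards it has at least $\lfloor f/4\rfloor$ elements. -/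

import Mathlib

namespace FaceGuards

/-- Euclidean three-space. -/
abbrev E3 : Type := EuclideanSpace ℝ (Fin 3)

/-- A closed, non-degenerate tetrahedron: the convex hull of four affinely independent points. -/
def IsTetrahedron (T : Set E3) : Prop :=
  ∃ v : Fin 4 → E3, AffineIndependent ℝ v ∧ T = convexHull ℝ (Set.range v)

/-- A polyhedron: a connected (non-empty) union of finitely many closed tetrahedra whose boundary,
with the subspace topology, is a topological 2-manifold without boundary. Any genus and any number
of cavities is allowed, and the boundary need not be connected.
(The boundary is a compact surface in three-space, hence automatically orientable; so orientability
is not an additional requirement.) -/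
structure IsPolyhedron (P : Set E3) : Prop where
  connected : IsConnected P
  union_tetrahedra : ∃ 𝒯 : Set (Set E3), 𝒯.Finite ∧ (∀ T ∈ 𝒯, IsTetrahedron T) ∧ P = ⋃₀ 𝒯
  manifold : Nonempty (ChartedSpace (EuclideanSpace ℝ (Fin 2)) (frontier P))

/-- A planar region contained in `S`: a two-dimensional planar subset of `S` whose relative
interior is connected and non-empty, and which has no parts (isolated points, whiskers) away from
the closure of its relative interior. -/
structure IsPlanarRegion (S F : Set E3) : Prop where
  subset : F ⊆ S
  planar : Module.finrank ℝ (vectorSpan ℝ F) = 2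
  connected : IsConnected (intrinsicInterior ℝ F)
  regular : F ⊆ closure (intrinsicInterior ℝ F)

/-- A (closed) face of `P`: a maximal planar region contained in the boundary of `P`. -/
def IsFace (P F : Set E3) : Prop :=
  Maximal (IsPlanarRegion (frontier P)) F

/-- The set of all faces of `P`. -/
def faces (P : Set E3) : Set (Set E3) := {F | IsFace P F}

/-- `P` is `c`-oriented: there are `c` unit vectors such that each face of `P` is orthogonal to
one of them. -/
def IsOriented (c : ℕ) (P : Set E3) : Prop :=
  ∃ u : Fin c → E3, (∀ i, ‖u i‖ = 1) ∧
    ∀ F ∈ faces P, ∃ i, ∀ w ∈ vectorSpan ℝ F, inner ℝ (u i) w = 0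

/-- `x` and `y` see each other in `P`: no point of the segment `xy` lies in the exterior of `P`. -/
def Visible (P : Set E3) (x y : E3) : Prop :=
  ∀ z ∈ segment ℝ x y, z ∉ interior Pᶜ

/-- The visible region of a set `S`: all points that are visible to some point of `S`. -/
def visibleRegion (P S : Set E3) : Set E3 := {y | ∃ x ∈ S, Visible P x y}

/-- `S` guards `P`: the visible region of `S` is all of `P`. -/
def Guards (P S : Set E3) : Prop := visibleRegion P S = P

/-- The set `G` of faces of `P`, used as open face guards (that is, each face taken without its
relative boundary), guards `P`. -/
def OpenFaceGuards (P : Set E3) (G : Set (Set E3)) : Prop :=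
  G ⊆ faces P ∧ Guards P (⋃ F ∈ G, intrinsicInterior ℝ F)

end FaceGuards

/-!
# Open face guards for 4-oriented polyhedra

**Sufficiency.** Split the four orientations into two pairs. The faces of one pair are at least half
of all faces, and there is a direction `e` parallel to all of them. So at most half of the faces are
transversal to `e`; call such a face an exit face for `e` if the polyhedron lies behind it, as seen
in direction `e`, near one of the points of the open face. The exit faces for `e` and those for `-e`
are disjoint (`disjoint_exitFaces`), and each of these two sets guards the polyhedron
(`openFaceGuards_exitFaces`); the smaller one has at most a quarter of the faces.

Disjointness means that `P` lies on one side of each open face. The boundary is a surface, so by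
invariance of domain an open face is open in the boundary (`exists_ball_inter_subset_of_relOpen`).
Hence `P` is on exactly one side near each point of the open face, and connectedness makes the side
constant (`not_both_sides`). The planar case of invariance of domain is derived from Borsuk's theorem
that odd maps of the circle into `ℂ \ {0}` have no continuous logarithm
(`image_closedBall_mem_nhds`).

That the exit faces guard `P` is `exists_visible_face`. From a point `x`, move by a small multiple of
a generic vector `d` into a tetrahedron containing `x`, then along `e` up to the first exit `y`.
By genericity `y` lies on only one of the planes of the tetrahedra, hence in an open face. Membership
in `P` depends only on the position relative to these finitely many planes. They meet the half-plane
spanned by `d` and `e` at `x` in lines whose order does not change close to `x`, so the segment from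
`x` to `y` stays in `P` (`exists_visible_exit`).

**Necessity.** The example for `f = 4 k + r`, `r < 4`, is a chain of `k` homothetic corner simplices,
the apex of each piercing the face of its predecessor that is opposite to the apex, with `r` corners
of the first simplex cut off. All faces lie in different planes, so they can be listed
(`faces_chain`). Each of the three outer vertices of a simplex is seen only by the faces of this
simplex and by one face of the predecessor, a different one for each vertex
(`owner_of_sees_witness`). Thus a simplex without guards forces three guards on its predecessor, and
`k` guards are needed (`le_encard_of_guards_chain`). The boundary of the chain is a surface because
it is locally the graph of a function over a plane (`nonempty_chartedSpace_frontier`).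
-/

namespace FaceGuards

open Set Topology Metric Filter

/-! ### Invariance of domain in the plane -/

/-- Continuous logarithms on the circle can be carried along homotopies in `ℂ \ {0}`. -/
theorem exists_log_of_homotopy (H : unitInterval × Circle → ℂ) (hH : Continuous H)
    (hne : ∀ p, H p ≠ 0) (h0 : ∃ φ : Circle → ℂ, Continuous φ ∧ ∀ z, Complex.exp (φ z) = H (0, z)) :
    ∃ φ : Circle → ℂ, Continuous φ ∧ ∀ z, Complex.exp (φ z) = H (1, z) := by
  obtain ⟨φ, hφ, hφH⟩ := h0
  let G : C(unitInterval × Circle, {z : ℂ // z ≠ 0}) :=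
    ⟨fun p => ⟨H p, hne p⟩, hH.subtype_mk _⟩
  have hG0 : ∀ a, G (0, a) = ⟨Complex.exp ((⟨φ, hφ⟩ : C(Circle, ℂ)) a), Complex.exp_ne_zero _⟩ :=
    fun a => Subtype.ext (hφH a).symm
  let K := Complex.isCoveringMap_exp.liftHomotopy G ⟨φ, hφ⟩ hG0
  have hK := Complex.isCoveringMap_exp.liftHomotopy_lifts G ⟨φ, hφ⟩ hG0
  refine ⟨fun z => K (1, z), by fun_prop, fun z => ?_⟩
  exact congrArg Subtype.val (congrFun hK (1, z))

/-- Borsuk: an odd map from the circle to `ℂ \ {0}` has no continuous logarithm. -/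
theorem not_exists_log_of_odd (h : Circle → ℂ) (hodd : ∀ z, h (-z) = -h z) :
    ¬ ∃ φ : Circle → ℂ, Continuous φ ∧ ∀ z, Complex.exp (φ z) = h z := by
  rintro ⟨φ, hφ, hφh⟩
  have key : ∀ z, ∃ n : ℤ, φ (-z) - φ z = (2 * n + 1) * (Real.pi * Complex.I) := by
    intro z
    have : Complex.exp (φ (-z)) = Complex.exp (φ z + Real.pi * Complex.I) := by
      rw [Complex.exp_add, Complex.exp_pi_mul_I, hφh, hφh, hodd]; ring
    obtain ⟨n, hn⟩ := Complex.exp_eq_exp_iff_exists_int.1 this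
    exact ⟨n, by rw [hn]; ring⟩
  choose n hn using key
  have hpi : (Real.pi * Complex.I : ℂ) ≠ 0 := by
    simp [Real.pi_ne_zero, Complex.I_ne_zero]
  have hcont : Continuous n := by
    have h1 : Continuous fun z => (n z : ℝ) := by
      have : (fun z => (n z : ℝ)) = fun z =>
          (((φ (-z) - φ z) / (Real.pi * Complex.I) - 1) / 2).re := by
        funext z
        rw [hn z, mul_div_cancel_right₀ _ hpi]
        have : ((2 * (n z : ℂ) + 1 - 1) / 2) = ((n z : ℝ) : ℂ) := by push_cast; ring
        rw [this, Complex.ofReal_re]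
      rw [this]
      have hneg : Continuous fun z : Circle => -z :=
        Continuous.subtype_mk (continuous_subtype_val.neg) _
      fun_prop
    exact Int.isClosedEmbedding_coe_real.isInducing.continuous_iff.2 h1
  have hconn : PreconnectedSpace Circle := inferInstance
  have hc : n 1 = n (-1) := hconn.constant hcont
  have h1 := hn 1
  have h2 := hn (-1)
  rw [neg_neg] at h2
  have h3 : ((2 * (n 1 : ℂ) + 1) + (2 * n (-1) + 1)) * (Real.pi * Complex.I) = 0 := by
    rw [add_mul, ← h1, ← h2]; ring
  rw [← hc] at h3
  have h4 := (mul_eq_zero.1 h3).resolve_right hpi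
  have h5 : (2 * n 1 + 1) + (2 * n 1 + 1) = 0 := by exact_mod_cast h4
  omega

/-- Invariance of domain in the plane: a continuous injection of the closed unit disc maps the
centre to an interior point of the image. If there were omitted values `c` arbitrarily near `f 0`,
then `f - c`, hence `f - f 0`, hence the odd map `z ↦ f (z / 2) - f (-z / 2)` would have a
continuous logarithm on the unit circle. -/
theorem image_closedBall_mem_nhds (f : ℂ → ℂ) (hf : ContinuousOn f (closedBall 0 1))
    (hinj : InjOn f (closedBall 0 1)) : f '' closedBall 0 1 ∈ 𝓝 (f 0) := by
  have cont_comp : ∀ {X : Type} [TopologicalSpace X] (g : X → ℂ), Continuous g →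
      (∀ x, ‖g x‖ ≤ 1) → Continuous fun x => f (g x) := fun g hg h1 =>
    hf.comp_continuous hg fun x => mem_closedBall_zero_iff.2 (h1 x)
  have h0mem : (0 : ℂ) ∈ closedBall (0 : ℂ) 1 := by simp
  have hS : IsCompact (sphere (0 : ℂ) 1) := isCompact_sphere _ _
  have hSne : (sphere (0 : ℂ) 1).Nonempty := ⟨1, by simp⟩
  obtain ⟨z0, hz0, hmin⟩ := hS.exists_isMinOn hSne
    ((hf.mono sphere_subset_closedBall).sub continuousOn_const |>.norm :
      ContinuousOn (fun z => ‖f z - f 0‖) (sphere 0 1))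
  set δ := ‖f z0 - f 0‖ with hδ
  have hδ0 : 0 < δ := by
    rw [hδ, norm_pos_iff, sub_ne_zero]
    intro h
    have := hinj (sphere_subset_closedBall hz0) h0mem h
    rw [this] at hz0; simp at hz0
  by_contra hcon
  obtain ⟨c, hcb, hcK⟩ : ∃ c ∈ ball (f 0) δ, c ∉ f '' closedBall 0 1 := by
    by_contra h
    push Not at h
    exact hcon (Filter.mem_of_superset (ball_mem_nhds _ hδ0) h)
  have hI : ∀ t : unitInterval, ‖((t : ℝ) : ℂ)‖ ≤ 1 := fun t => by
    rw [Complex.norm_real, Real.norm_of_nonneg t.2.1]; exact t.2.2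
  have htz : ∀ p : unitInterval × Circle, ‖((p.1 : ℝ) : ℂ) * (p.2 : ℂ)‖ ≤ 1 := fun p => by
    rw [norm_mul, Circle.norm_coe, mul_one]; exact hI _
  -- contract the circle inside the disc
  have L1 := exists_log_of_homotopy (fun p => f (((p.1 : ℝ) : ℂ) * p.2) - c)
    ((cont_comp _ (by fun_prop) htz).sub continuous_const)
    (fun p h => hcK ⟨_, mem_closedBall_zero_iff.2 (htz p), sub_eq_zero.1 h⟩)
    ⟨fun _ => Complex.log (f 0 - c), continuous_const, fun z => by
      simp only [Set.Icc.coe_zero, Complex.ofReal_zero, zero_mul]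
      exact Complex.exp_log (fun h => hcK ⟨0, h0mem, sub_eq_zero.1 h⟩)⟩
  simp only [Set.Icc.coe_one, Complex.ofReal_one, one_mul] at L1
  -- move `c` to `f 0`
  have L2 := exists_log_of_homotopy
    (fun p => f p.2 - (c + ((p.1 : ℝ) : ℂ) * (f 0 - c)))
    ((cont_comp (fun p : unitInterval × Circle => (p.2 : ℂ)) (by fun_prop)
      (fun p => (Circle.norm_coe p.2).le)).sub (by fun_prop))
    (fun p h => by
      have h1 : δ ≤ ‖f p.2 - f 0‖ := hmin (mem_sphere_zero_iff_norm.2 (Circle.norm_coe p.2))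
      have h2 : f p.2 - f 0 = ((1 - (p.1 : ℝ) : ℝ) : ℂ) * (c - f 0) := by
        rw [sub_eq_zero.1 h]; push_cast; ring
      have h3 : ‖c - f 0‖ < δ := by rwa [mem_ball, dist_eq_norm] at hcb
      rw [h2, norm_mul, Complex.norm_real, Real.norm_of_nonneg (by linarith [p.1.2.2])] at h1
      nlinarith [p.1.2.1, norm_nonneg (c - f 0)])
    (by simpa using L1)
  simp only [Set.Icc.coe_one, Complex.ofReal_one, one_mul, add_sub_cancel] at L2
  have bd1 : ∀ p : unitInterval × Circle, ‖(((1 / (1 + p.1) : ℝ)) : ℂ) * (p.2 : ℂ)‖ ≤ 1 := fun p => by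
    have := p.1.2.1
    rw [norm_mul, Circle.norm_coe, mul_one, Complex.norm_real, Real.norm_of_nonneg (by positivity),
      div_le_one (by linarith)]; linarith
  have bd2 : ∀ p : unitInterval × Circle, ‖(((-(p.1 / (1 + p.1)) : ℝ)) : ℂ) * (p.2 : ℂ)‖ ≤ 1 :=
    fun p => by
    have := p.1.2.1
    rw [norm_mul, Circle.norm_coe, mul_one, Complex.norm_real, norm_neg,
      Real.norm_of_nonneg (by positivity), div_le_one (by linarith)]; linarith
  have c1 : Continuous fun p : unitInterval × Circle => (1 / (1 + p.1) : ℝ) :=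
    continuous_const.div (by fun_prop) (fun p => by linarith [p.1.2.1])
  have c2 : Continuous fun p : unitInterval × Circle => (-(p.1 / (1 + p.1)) : ℝ) :=
    (Continuous.div (by fun_prop) (by fun_prop) (fun p => by linarith [p.1.2.1])).neg
  have L3 := exists_log_of_homotopy
    (fun p => f (((1 / (1 + p.1) : ℝ) : ℂ) * p.2) - f (((-(p.1 / (1 + p.1)) : ℝ) : ℂ) * p.2))
    ((cont_comp _ ((Complex.continuous_ofReal.comp c1).mul (by fun_prop)) bd1).sub
      (cont_comp _ ((Complex.continuous_ofReal.comp c2).mul (by fun_prop)) bd2))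
    (fun p h => by
      have := hinj (mem_closedBall_zero_iff.2 (bd1 p)) (mem_closedBall_zero_iff.2 (bd2 p))
        (sub_eq_zero.1 h)
      have h2 := mul_right_cancel₀ (Circle.coe_ne_zero p.2) this
      have h3 : (1 / (1 + p.1) : ℝ) = -(p.1 / (1 + p.1)) := by exact_mod_cast h2
      have h4 := p.1.2.1
      have h5 : (0 : ℝ) < 1 / (1 + p.1) := by positivity
      have h6 : (0 : ℝ) ≤ p.1 / (1 + p.1) := by positivity
      linarith)
    (by simpa using L2)
  refine not_exists_log_of_odd _ (fun z => ?_) L3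
  have e : (1 / (1 + ((1 : unitInterval) : ℝ))) = 1 / 2 := by norm_num
  have e' : (-(((1 : unitInterval) : ℝ) / (1 + ((1 : unitInterval) : ℝ)))) = -(1 / 2) := by norm_num
  have e3 : ((-z : Circle) : ℂ) = -(z : ℂ) := rfl
  simp only [e, e', e3]
  push_cast
  ring_nf

/-! ### Planes, planar regions and faces -/

/-- The plane `φ x = b` (a genuine plane when `φ ≠ 0`). -/
def plane (φ : E3 →L[ℝ] ℝ) (b : ℝ) : Set E3 := {x | φ x = b}

/-- `U` is a relatively open subset of the plane `φ x = b`. -/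
def RelOpen (φ : E3 →L[ℝ] ℝ) (b : ℝ) (U : Set E3) : Prop :=
  U ⊆ plane φ b ∧ ∀ x ∈ U, ∃ ε > 0, ball x ε ∩ plane φ b ⊆ U

theorem isClosed_plane (φ : E3 →L[ℝ] ℝ) (b : ℝ) : IsClosed (plane φ b) :=
  isClosed_eq φ.continuous continuous_const

theorem convex_plane (φ : E3 →L[ℝ] ℝ) (b : ℝ) : Convex ℝ (plane φ b) :=
  convex_hyperplane φ.toLinearMap.isLinear b

theorem isPreconnected_ball_inter_plane (φ : E3 →L[ℝ] ℝ) (b : ℝ) (x : E3) (ε : ℝ) :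
    IsPreconnected (ball x ε ∩ plane φ b) :=
  ((convex_ball x ε).inter (convex_plane φ b)).isPreconnected

theorem add_mem_plane {φ : E3 →L[ℝ] ℝ} {b : ℝ} {x w : E3} (hx : x ∈ plane φ b) (hw : φ w = 0) :
    x + w ∈ plane φ b := by
  simp only [plane, mem_ofPred_eq, map_add, hw, add_zero] at hx ⊢
  exact hx

theorem finrank_ker {φ : E3 →L[ℝ] ℝ} (hφ : φ ≠ 0) :
    Module.finrank ℝ (LinearMap.ker φ.toLinearMap) = 2 := by
  have h := Module.Dual.finrank_ker_add_one_of_ne_zero (f := φ.toLinearMap)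
    (fun h => hφ (ContinuousLinearMap.coe_injective h))
  rw [finrank_euclideanSpace_fin] at h
  omega

theorem mem_intrinsicInterior_iff_ball {s : Set E3} {x : E3} :
    x ∈ intrinsicInterior ℝ s ↔
      x ∈ affineSpan ℝ s ∧ ∃ ε > 0, ball x ε ∩ (affineSpan ℝ s : Set E3) ⊆ s := by
  rw [mem_intrinsicInterior]
  constructor
  · rintro ⟨y, hy, rfl⟩
    refine ⟨y.2, ?_⟩
    obtain ⟨ε, hε, h⟩ := Metric.mem_nhds_iff.1 (mem_interior_iff_mem_nhds.1 hy)
    exact ⟨ε, hε, fun z hz => h (show (⟨z, hz.2⟩ : affineSpan ℝ s) ∈ ball y ε from hz.1)⟩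
  · rintro ⟨hx, ε, hε, h⟩
    refine ⟨⟨x, hx⟩, mem_interior_iff_mem_nhds.2 (Metric.mem_nhds_iff.2 ⟨ε, hε, ?_⟩), rfl⟩
    exact fun z hz => h ⟨hz, z.2⟩

theorem nonempty_of_finrank {F : Set E3} (hF : Module.finrank ℝ (vectorSpan ℝ F) = 2) :
    F.Nonempty := by
  by_contra h
  rw [not_nonempty_iff_eq_empty] at h
  rw [h, vectorSpan_empty] at hF
  simp at hF

theorem vectorSpan_le_ker {φ : E3 →L[ℝ] ℝ} {b : ℝ} {F : Set E3} (hF : F ⊆ plane φ b) :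
    vectorSpan ℝ F ≤ LinearMap.ker φ.toLinearMap := by
  rw [vectorSpan, Submodule.span_le]
  rintro _ ⟨x, hx, y, hy, rfl⟩
  have h1 : φ x = b := hF hx
  have h2 : φ y = b := hF hy
  simp [h1, h2]

theorem vectorSpan_eq_ker {φ : E3 →L[ℝ] ℝ} (hφ : φ ≠ 0) {b : ℝ} {F : Set E3}
    (hF : F ⊆ plane φ b) (h2 : Module.finrank ℝ (vectorSpan ℝ F) = 2) :
    vectorSpan ℝ F = LinearMap.ker φ.toLinearMap :=
  Submodule.eq_of_le_of_finrank_eq (vectorSpan_le_ker hF) (by rw [h2, finrank_ker hφ])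

theorem affineSpan_eq_plane {φ : E3 →L[ℝ] ℝ} (hφ : φ ≠ 0) {b : ℝ} {F : Set E3}
    (hF : F ⊆ plane φ b) (h2 : Module.finrank ℝ (vectorSpan ℝ F) = 2) :
    (affineSpan ℝ F : Set E3) = plane φ b := by
  obtain ⟨p, hp⟩ := nonempty_of_finrank h2
  ext x
  have hpb : φ p = b := hF hp
  rw [SetLike.mem_coe, ← AffineSubspace.vsub_right_mem_direction_iff_mem (mem_affineSpan ℝ hp),
    direction_affineSpan, vectorSpan_eq_ker hφ hF h2]
  simp [plane, hpb, sub_eq_zero]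

/-- A set that lies in a plane and contains a relatively open piece of it spans the plane. -/
theorem finrank_vectorSpan_of_relOpen {φ : E3 →L[ℝ] ℝ} (hφ : φ ≠ 0) {b : ℝ} {U F : Set E3}
    (hU : RelOpen φ b U) (hne : U.Nonempty) (hUF : U ⊆ F) (hF : F ⊆ plane φ b) :
    Module.finrank ℝ (vectorSpan ℝ F) = 2 := by
  have : vectorSpan ℝ F = LinearMap.ker φ.toLinearMap := by
    refine le_antisymm (vectorSpan_le_ker hF) fun w hw => ?_
    obtain ⟨x, hx⟩ := hne
    obtain ⟨ε, hε, hb⟩ := hU.2 x hx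
    by_cases hw0 : w = 0
    · rw [hw0]; exact zero_mem _
    have hwn : 0 < ‖w‖ := norm_pos_iff.2 hw0
    set t : ℝ := ε / 2 / ‖w‖ with ht
    have ht0 : 0 < t := by positivity
    have hmem : x + t • w ∈ F := by
      refine hUF (hb ⟨?_, add_mem_plane (hU.1 hx) ?_⟩)
      · rw [mem_ball, dist_eq_norm, add_sub_cancel_left, norm_smul, Real.norm_of_nonneg ht0.le, ht,
          div_mul_cancel₀ _ hwn.ne']
        linarith
      · have : φ w = 0 := hw
        simp [this]
    have h1 := vsub_mem_vectorSpan ℝ hmem (hUF hx)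
    rw [vsub_eq_sub, add_sub_cancel_left] at h1
    exact (Submodule.smul_mem_iff _ ht0.ne').1 h1
  rw [this, finrank_ker hφ]

theorem subset_intrinsicInterior_of_relOpen {φ : E3 →L[ℝ] ℝ} (hφ : φ ≠ 0) {b : ℝ} {U F : Set E3}
    (hU : RelOpen φ b U) (hUF : U ⊆ F) (hF : F ⊆ plane φ b) :
    U ⊆ intrinsicInterior ℝ F := by
  intro x hx
  have h2 := finrank_vectorSpan_of_relOpen hφ hU ⟨x, hx⟩ hUF hF
  rw [mem_intrinsicInterior_iff_ball, ← SetLike.mem_coe, affineSpan_eq_plane hφ hF h2]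
  obtain ⟨ε, hε, h⟩ := hU.2 x hx
  exact ⟨hU.1 hx, ε, hε, h.trans hUF⟩

theorem relOpen_intrinsicInterior {φ : E3 →L[ℝ] ℝ} (hφ : φ ≠ 0) {b : ℝ} {F : Set E3}
    (hF : F ⊆ plane φ b) (h2 : Module.finrank ℝ (vectorSpan ℝ F) = 2) :
    RelOpen φ b (intrinsicInterior ℝ F) := by
  refine ⟨intrinsicInterior_subset.trans hF, fun x hx => ?_⟩
  have hx' := hx
  rw [mem_intrinsicInterior_iff_ball, ← SetLike.mem_coe, affineSpan_eq_plane hφ hF h2] at hx'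
  obtain ⟨-, ε, hε, h⟩ := hx'
  refine ⟨ε, hε, fun y hy => ?_⟩
  rw [mem_intrinsicInterior_iff_ball, ← SetLike.mem_coe, affineSpan_eq_plane hφ hF h2]
  refine ⟨hy.2, ε - dist y x, by have := hy.1; rw [mem_ball] at this; linarith, ?_⟩
  refine (inter_subset_inter_left _ (ball_subset_ball' ?_)).trans h
  linarith

theorem exists_plane {F : Set E3} (h2 : Module.finrank ℝ (vectorSpan ℝ F) = 2) :
    ∃ φ : E3 →L[ℝ] ℝ, φ ≠ 0 ∧ ∃ b, F ⊆ plane φ b := by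
  obtain ⟨p, hp⟩ := nonempty_of_finrank h2
  have h1 := Submodule.finrank_add_finrank_orthogonal (vectorSpan ℝ F)
  rw [h2, finrank_euclideanSpace_fin] at h1
  have hne : (vectorSpan ℝ F)ᗮ ≠ ⊥ := by
    intro h
    rw [h, finrank_bot] at h1
    omega
  obtain ⟨n, hn, hn0⟩ := Submodule.exists_mem_ne_zero_of_ne_bot hne
  refine ⟨innerSL ℝ n, fun h => hn0 ?_, inner ℝ n p, fun x hx => ?_⟩
  · have : innerSL ℝ n n = 0 := by rw [h]; rfl
    simpa using this
  · have := (Submodule.mem_orthogonal' _ _).1 hn _ (vsub_mem_vectorSpan ℝ hx hp)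
    rw [vsub_eq_sub, inner_sub_right, sub_eq_zero] at this
    exact this

/-- A connected relatively open piece `U` of a plane, together with any part of its closure, is a
planar region. -/
theorem isPlanarRegion_of_relOpen {φ : E3 →L[ℝ] ℝ} (hφ : φ ≠ 0) {b : ℝ} {S U F : Set E3}
    (hU : RelOpen φ b U) (hconn : IsConnected U) (hUF : U ⊆ F) (hFU : F ⊆ closure U)
    (hFS : F ⊆ S) : IsPlanarRegion S F := by
  have hF : F ⊆ plane φ b := hFU.trans ((isClosed_plane φ b).closure_subset_iff.2 hU.1)
  have hUI := subset_intrinsicInterior_of_relOpen hφ hU hUF hF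
  exact ⟨hFS, finrank_vectorSpan_of_relOpen hφ hU hconn.nonempty hUF hF,
    hconn.subset_closure hUI (intrinsicInterior_subset.trans hFU),
    hFU.trans (closure_mono hUI)⟩

/-- Every disc contained in a closed set `S` lies in a maximal planar region of `S`, namely the
closure of a connected component of the relative interior of the section of `S` by the plane. -/
theorem exists_maximal_planarRegion {S : Set E3} (hS : IsClosed S) {φ : E3 →L[ℝ] ℝ} (hφ : φ ≠ 0)
    {b : ℝ} {y : E3} (hy : y ∈ plane φ b) {ε : ℝ} (hε : 0 < ε) (h : ball y ε ∩ plane φ b ⊆ S) :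
    ∃ F, Maximal (IsPlanarRegion S) F ∧ y ∈ intrinsicInterior ℝ F ∧ F ⊆ plane φ b := by
  set W : Set E3 := {x | x ∈ plane φ b ∧ ∃ ε > 0, ball x ε ∩ plane φ b ⊆ S} with hW
  have hyW : y ∈ W := ⟨hy, ε, hε, h⟩
  set C := connectedComponentIn W y
  have hCW : C ⊆ W := connectedComponentIn_subset _ _
  have hWS : W ⊆ S := fun x hx => by
    obtain ⟨h1, δ, hδ, h2⟩ := hx
    exact h2 ⟨mem_ball_self hδ, h1⟩
  have hball : ∀ x ∈ W, ∃ δ > 0, ball x δ ∩ plane φ b ⊆ W := by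
    rintro x ⟨hx, δ, hδ, h2⟩
    refine ⟨δ, hδ, fun z hz => ⟨hz.2, δ - dist z x, ?_, ?_⟩⟩
    · have := hz.1; rw [mem_ball] at this; linarith
    · exact (inter_subset_inter_left _ (ball_subset_ball' (by linarith))).trans h2
  have hCopen : RelOpen φ b C := by
    refine ⟨fun x hx => (hCW hx).1, fun x hx => ?_⟩
    obtain ⟨δ, hδ, h2⟩ := hball x (hCW hx)
    refine ⟨δ, hδ, ?_⟩
    have e : C = connectedComponentIn W x := connectedComponentIn_eq hx
    rw [e]
    exact (isPreconnected_ball_inter_plane φ b x δ).subset_connectedComponentIn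
      ⟨mem_ball_self hδ, (hCW hx).1⟩ h2
  have hCconn : IsConnected C := isConnected_connectedComponentIn_iff.2 hyW
  have hyC : y ∈ C := mem_connectedComponentIn hyW
  have hFpl : closure C ⊆ plane φ b := (isClosed_plane φ b).closure_subset_iff.2 hCopen.1
  have hreg : IsPlanarRegion S (closure C) :=
    isPlanarRegion_of_relOpen hφ hCopen hCconn subset_closure subset_rfl
      (hS.closure_subset_iff.2 (hCW.trans hWS))
  have hmax : Maximal (IsPlanarRegion S) (closure C) := by
    refine ⟨hreg, fun F' hF' hle => ?_⟩
    have hpl' : F' ⊆ plane φ b := by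
      obtain ⟨ψ, hψ, c, hc⟩ := exists_plane hF'.planar
      rw [← affineSpan_eq_plane hφ hFpl hreg.planar,
        affineSpan_eq_plane hψ (hle.trans hc) hreg.planar]
      exact hc
    have hro := relOpen_intrinsicInterior hφ hpl' hF'.planar
    have hsub : intrinsicInterior ℝ F' ⊆ W := fun x hx => by
      obtain ⟨δ, hδ, h2⟩ := hro.2 x hx
      exact ⟨hro.1 hx, δ, hδ, h2.trans (intrinsicInterior_subset.trans hF'.subset)⟩
    have hyF' : y ∈ intrinsicInterior ℝ F' :=
      subset_intrinsicInterior_of_relOpen hφ hCopen (subset_closure.trans hle) hpl' hyC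
    exact hF'.regular.trans (closure_mono
      (hF'.connected.isPreconnected.subset_connectedComponentIn hyF' hsub))
  exact ⟨_, hmax, subset_intrinsicInterior_of_relOpen hφ hCopen subset_closure hFpl hyC, hFpl⟩

theorem exists_forall_ne_zero {ι : Type*} [Finite ι] (p : Submodule ℝ E3) (φ : ι → E3 →L[ℝ] ℝ)
    (h : ∀ i, ∃ w ∈ p, φ i w ≠ 0) : ∃ w ∈ p, ∀ i, φ i w ≠ 0 :=
  Module.Dual.exists_forall_mem_ne_zero_of_forall_exists p (fun i => (φ i).toLinearMap) h

/-- A non-zero affine function of one variable has no zeros immediately to the right of `0`. -/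
theorem eventually_affine_ne (a b : ℝ) (h : a ≠ 0 ∨ b ≠ 0) :
    ∀ᶠ t in 𝓝[>] (0 : ℝ), a + b * t ≠ 0 := by
  by_cases ha : a = 0
  · have hb := h.resolve_left (not_not.2 ha)
    filter_upwards [self_mem_nhdsWithin] with t ht
    rw [ha, zero_add]
    exact mul_ne_zero hb (ne_of_gt ht)
  · have : ContinuousAt (fun t : ℝ => a + b * t) 0 := by fun_prop
    exact (this.eventually_ne (by simpa using ha)).filter_mono nhdsWithin_le_nhds

/-- If a closed set is a finite union of closed planar regions in pairwise distinct planes, then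
these are its maximal planar regions. -/
theorem maximal_planarRegion_iff_of_iUnion {ι : Type*} [Finite ι] {S : Set E3}
    {φ : ι → E3 →L[ℝ] ℝ} (hφ : ∀ i, φ i ≠ 0) {b : ι → ℝ} {F : ι → Set E3}
    (hS : S = ⋃ i, F i) (hcl : ∀ i, IsClosed (F i)) (hpl : ∀ i, F i ⊆ plane (φ i) (b i))
    (hreg : ∀ i, IsPlanarRegion S (F i))
    (hne : ∀ i j, plane (φ i) (b i) = plane (φ j) (b j) → i = j) (G : Set E3) :
    Maximal (IsPlanarRegion S) G ↔ ∃ i, G = F i := by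
  -- a planar region lying in none of the given planes would be covered by finitely many lines
  have key : ∀ G, IsPlanarRegion S G → ∃ i, G ⊆ F i := by
    intro G hG
    obtain ⟨ψ, hψ, c, hc⟩ := exists_plane hG.planar
    have hro := relOpen_intrinsicInterior hψ hc hG.planar
    have main : ∀ x ∈ intrinsicInterior ℝ G, ∀ ε > 0, ∃ y ∈ ball x ε, ∃ i, y ∈ F i ∧
        plane (φ i) (b i) = plane ψ c := by
      intro x hx ε hε
      obtain ⟨δ, hδ, hball⟩ := hro.2 x hx
      have hxc : ψ x = c := hro.1 hx
      let J := {i : ι // ∃ w ∈ LinearMap.ker ψ.toLinearMap, φ i w ≠ 0}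
      obtain ⟨w, hw, hwJ⟩ := exists_forall_ne_zero (LinearMap.ker ψ.toLinearMap)
        (fun j : J => φ j.1) (fun j => j.2)
      have hw' : ψ w = 0 := hw
      have ev1 : ∀ᶠ t in 𝓝[>] (0 : ℝ), ∀ j : J, (φ j.1 x - b j.1) + φ j.1 w * t ≠ 0 :=
        Filter.eventually_all.2 fun j => eventually_affine_ne _ _ (Or.inr (hwJ j))
      have ev2 : ∀ᶠ t in 𝓝[>] (0 : ℝ), x + t • w ∈ ball x (min ε δ) := by
        have : ContinuousAt (fun t : ℝ => x + t • w) 0 := by fun_prop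
        refine (this.eventually_mem (isOpen_ball.mem_nhds ?_)).filter_mono nhdsWithin_le_nhds
        simpa using ⟨hε, hδ⟩
      obtain ⟨t, ht1, ht2⟩ := (ev1.and ev2).exists
      rw [mem_ball, lt_min_iff] at ht2
      have hmem : x + t • w ∈ plane ψ c := add_mem_plane hxc (by simp [hw'])
      have hyS : x + t • w ∈ S := hG.subset (intrinsicInterior_subset (hball ⟨ht2.2, hmem⟩))
      rw [hS, mem_iUnion] at hyS
      obtain ⟨i, hi⟩ := hyS
      refine ⟨x + t • w, ht2.1, i, hi, ?_⟩
      have hiJ : ¬ ∃ w ∈ LinearMap.ker ψ.toLinearMap, φ i w ≠ 0 := by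
        intro hJ
        refine ht1 ⟨i, hJ⟩ ?_
        have : φ i (x + t • w) = b i := hpl i hi
        simp only [map_add, map_smul, smul_eq_mul] at this
        linarith
      push Not at hiJ
      have hker : LinearMap.ker ψ.toLinearMap = LinearMap.ker (φ i).toLinearMap :=
        Submodule.eq_of_le_of_finrank_eq (fun w hw => hiJ w hw)
          (by rw [finrank_ker hψ, finrank_ker (hφ i)])
      have hbi : φ i (x + t • w) = b i := hpl i hi
      have hci : ψ (x + t • w) = c := hmem
      ext z
      have := SetLike.ext_iff.1 hker (z - (x + t • w))
      simp only [LinearMap.mem_ker, ContinuousLinearMap.coe_coe, map_sub, hbi, hci,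
        sub_eq_zero] at this
      exact this.symm
    obtain ⟨x0, hx0⟩ := hG.connected.nonempty
    obtain ⟨-, -, i, -, hi⟩ := main x0 hx0 1 one_pos
    refine ⟨i, hG.regular.trans ((hcl i).closure_subset_iff.2 fun x hx => ?_)⟩
    rw [← (hcl i).closure_eq]
    refine Metric.mem_closure_iff.2 fun ε hε => ?_
    obtain ⟨y, hy, j, hyj, hj⟩ := main x hx ε hε
    rw [hne j i (hj.trans hi.symm)] at hyj
    exact ⟨y, hyj, by rwa [dist_comm]⟩
  constructor
  · intro hG
    obtain ⟨i, hi⟩ := key G hG.1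
    exact ⟨i, hi.antisymm (hG.2 (hreg i) hi)⟩
  · rintro ⟨i, rfl⟩
    refine ⟨hreg i, fun G hG hle => ?_⟩
    obtain ⟨j, hj⟩ := key G hG
    have hij : F i ⊆ F j := hle.trans hj
    have : plane (φ i) (b i) = plane (φ j) (b j) := by
      rw [← affineSpan_eq_plane (hφ i) (hpl i) (hreg i).planar,
        ← affineSpan_eq_plane (hφ j) (hij.trans (hpl j)) (hreg i).planar]
    rw [hne i j this]
    exact hj

/-! ### Sets determined by the signs of finitely many affine functions -/

/-- Membership in `P` depends only on the signs of the affine functions `φ i x - b i`. -/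
def SignDetermined {ι : Type*} (φ : ι → E3 →L[ℝ] ℝ) (b : ι → ℝ) (P : Set E3) : Prop :=
  ∀ x y, (∀ i, SignType.sign (φ i x - b i) = SignType.sign (φ i y - b i)) → x ∈ P → y ∈ P

/-- A tetrahedron is the intersection of four half-spaces. -/
theorem IsTetrahedron.exists_halfspaces {T : Set E3} (hT : IsTetrahedron T) :
    (∃ (φ : Fin 4 → E3 →L[ℝ] ℝ) (b : Fin 4 → ℝ), (∀ i, φ i ≠ 0) ∧ T = {x | ∀ i, b i ≤ φ i x}) ∧
      (interior T).Nonempty ∧ IsCompact T ∧ Convex ℝ T := by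
  obtain ⟨v, hv, rfl⟩ := hT
  have htop : affineSpan ℝ (range v) = ⊤ := by
    rw [hv.affineSpan_eq_top_iff_card_eq_finrank_add_one, finrank_euclideanSpace_fin]
    simp
  let B : AffineBasis (Fin 4) ℝ E3 := ⟨v, hv, htop⟩
  have hB : (B : Fin 4 → E3) = v := rfl
  have hc : ∀ i x, B.coord i x = (B.coord i).linear x + B.coord i 0 := fun i x => by
    rw [← vadd_eq_add, ← AffineMap.map_vadd]; simp
  refine ⟨⟨fun i => LinearMap.toContinuousLinearMap (B.coord i).linear, fun i => -B.coord i 0,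
    fun i h => ?_, ?_⟩, ?_, ?_, convex_convexHull _ _⟩
  · obtain ⟨j, hj⟩ := exists_ne i
    have h0 : ∀ x, (B.coord i).linear x = 0 := fun x =>
      congrArg (fun ψ : E3 →L[ℝ] ℝ => ψ x) h
    have h1 := hc i (B i)
    have h2 := hc i (B j)
    rw [h0, AffineBasis.coord_apply_eq] at h1
    rw [h0, AffineBasis.coord_apply_ne _ hj.symm] at h2
    linarith
  · rw [← hB, B.convexHull_eq_nonneg_coord]
    ext x
    simp only [mem_ofPred_eq, LinearMap.coe_toContinuousLinearMap']
    refine forall_congr' fun i => ?_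
    rw [hc i x]
    constructor <;> intro h <;> linarith
  · rw [interior_convexHull_nonempty_iff_affineSpan_eq_top]
    exact htop
  · exact (finite_range v).isCompact_convexHull ℝ

/-- A finite union of tetrahedra is sign-determined and compact, and each of its points lies in a
convex subset with non-empty interior. -/
theorem exists_signDetermined {P : Set E3}
    (h : ∃ 𝒯 : Set (Set E3), 𝒯.Finite ∧ (∀ T ∈ 𝒯, IsTetrahedron T) ∧ P = ⋃₀ 𝒯) :
    (∃ (ι : Type) (_ : Finite ι) (φ : ι → E3 →L[ℝ] ℝ) (b : ι → ℝ), (∀ i, φ i ≠ 0) ∧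
      SignDetermined φ b P) ∧ IsCompact P ∧
      ∀ x ∈ P, ∃ T ⊆ P, x ∈ T ∧ Convex ℝ T ∧ (interior T).Nonempty := by
  obtain ⟨𝒯, hfin, hT, rfl⟩ := h
  have : Finite 𝒯 := hfin
  choose φ b hφ hTeq using fun T : 𝒯 => (hT T.1 T.2).exists_halfspaces.1
  refine ⟨⟨𝒯 × Fin 4, inferInstance, fun p => φ p.1 p.2, fun p => b p.1 p.2,
    fun p => hφ p.1 p.2, ?_⟩, hfin.isCompact_sUnion fun T hTm => (hT T hTm).exists_halfspaces.2.2.1,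
    ?_⟩
  · rintro x y hs ⟨T, hTm, hx⟩
    refine ⟨T, hTm, ?_⟩
    have e := hTeq ⟨T, hTm⟩
    simp only at e
    rw [e] at hx ⊢
    intro i
    have h1 := hs (⟨T, hTm⟩, i)
    have h2 := sub_nonneg.2 (hx i)
    rw [← sign_nonneg_iff] at h2
    simp only at h1
    rw [h1, sign_nonneg_iff] at h2
    exact sub_nonneg.1 h2
  · rintro x ⟨T, hTm, hx⟩
    exact ⟨T, subset_sUnion_of_mem hTm, hx, (hT T hTm).exists_halfspaces.2.2.2,
      (hT T hTm).exists_halfspaces.2.1⟩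

/-- Near `y` the affine functions that do not vanish at `y` keep their signs. -/
theorem eventually_sign_eq {ι : Type*} [Finite ι] (φ : ι → E3 →L[ℝ] ℝ) (b : ι → ℝ) (y : E3) :
    ∀ᶠ z in 𝓝 y, ∀ i, φ i y ≠ b i →
      SignType.sign (φ i z - b i) = SignType.sign (φ i y - b i) := by
  refine eventually_all.2 fun i => ?_
  by_cases h : φ i y = b i
  · exact Eventually.of_forall fun z hz => absurd h hz
  have hc : ContinuousAt (fun z => φ i z - b i) y := by fun_prop
  rcases lt_or_gt_of_ne h with hlt | hgt
  · filter_upwards [hc.eventually_lt_const (show φ i y - b i < 0 by linarith)] with z hz _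
    rw [sign_neg hz, sign_neg (by linarith)]
  · filter_upwards [hc.eventually_const_lt (show 0 < φ i y - b i by linarith)] with z hz _
    rw [sign_pos hz, sign_pos (by linarith)]

theorem exists_eq_of_mem_frontier {ι : Type*} [Finite ι] {φ : ι → E3 →L[ℝ] ℝ} {b : ι → ℝ}
    {P : Set E3} (hP : SignDetermined φ b P) (hcl : IsClosed P) {y : E3} (hy : y ∈ frontier P) :
    ∃ i, φ i y = b i := by
  by_contra h
  push Not at h
  rw [hcl.frontier_eq] at hy
  refine hy.2 (mem_interior_iff_mem_nhds.2 ?_)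
  filter_upwards [eventually_sign_eq φ b y] with z hz
  exact hP y z (fun i => (hz i (h i)).symm) hy.1

theorem mem_plane_iff_of_plane_eq {φ ψ : E3 →L[ℝ] ℝ} {b c : ℝ} (h : plane φ b = plane ψ c)
    (z : E3) : φ z = b ↔ ψ z = c := Set.ext_iff.1 h z

/-- At a boundary point that lies on only one of the planes, the boundary contains a disc of that
plane, and the points of `P` off the plane are interior. -/
theorem exists_ball_of_generic {ι : Type*} [Finite ι] {φ : ι → E3 →L[ℝ] ℝ} {b : ι → ℝ}
    {P : Set E3} (hP : SignDetermined φ b P) (hcl : IsClosed P) {y : E3} (hy : y ∈ frontier P)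
    {i₀ : ι} (hgen : ∀ i, φ i y = b i → plane (φ i) (b i) = plane (φ i₀) (b i₀)) :
    ∃ r > 0, ball y r ∩ plane (φ i₀) (b i₀) ⊆ frontier P ∧
      ∀ z ∈ ball y r, z ∈ P → z ∉ plane (φ i₀) (b i₀) → z ∈ interior P := by
  obtain ⟨r, hr, hball⟩ := Metric.eventually_nhds_iff_ball.1 (eventually_sign_eq φ b y)
  have hyP : y ∈ P := hcl.frontier_subset hy
  have honP : ∀ z ∈ ball y r, z ∈ plane (φ i₀) (b i₀) → z ∈ P := by
    intro z hz hzp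
    refine hP y z (fun i => ?_) hyP
    by_cases h : φ i y = b i
    · rw [h, (mem_plane_iff_of_plane_eq (hgen i h) z).2 hzp, sub_self]
    · exact (hball z hz i h).symm
  refine ⟨r, hr, ?_, ?_⟩
  · rintro z ⟨hz, hzp⟩
    rw [hcl.frontier_eq]
    refine ⟨honP z hz hzp, fun hzi => ?_⟩
    rw [hcl.frontier_eq] at hy
    refine hy.2 (mem_interior_iff_mem_nhds.2 (mem_of_superset (ball_mem_nhds y hr) ?_))
    intro v hv
    by_cases hvp : v ∈ plane (φ i₀) (b i₀)
    · exact honP v hv hvp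
    -- a point near `z` in the direction of `v` has the same signs as `v`
    have ev : ∀ᶠ t in 𝓝[>] (0 : ℝ), z + t • (v - z) ∈ P := by
      have : ContinuousAt (fun t : ℝ => z + t • (v - z)) 0 := by fun_prop
      exact (this.eventually_mem (by simpa using mem_interior_iff_mem_nhds.1 hzi)).filter_mono
        nhdsWithin_le_nhds
    obtain ⟨t, ht, ht0, ht1⟩ :=
      (ev.and (Ioo_mem_nhdsGT (show (0 : ℝ) < 1 by norm_num))).exists
    have hmem : z + t • (v - z) ∈ ball y r :=
      (convex_ball y r).add_smul_sub_mem hz hv ⟨ht0.le, ht1.le⟩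
    refine hP _ v (fun i => ?_) ht
    by_cases h : φ i y = b i
    · have hz0 := (mem_plane_iff_of_plane_eq (hgen i h) z).2 hzp
      have : φ i (z + t • (v - z)) - b i = t * (φ i v - b i) := by
        simp only [map_add, map_smul, map_sub, hz0, smul_eq_mul]; ring
      rw [this, sign_mul, sign_pos ht0, one_mul]
    · rw [hball _ hmem i h, hball _ hv i h]
  · intro z hz hzP hzn
    by_contra hzi
    have hzf : z ∈ frontier P := by rw [hcl.frontier_eq]; exact ⟨hzP, hzi⟩
    obtain ⟨i, hi⟩ := exists_eq_of_mem_frontier hP hcl hzf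
    by_cases h : φ i y = b i
    · exact hzn ((mem_plane_iff_of_plane_eq (hgen i h) z).1 hi)
    · have := hball z hz i h
      rw [hi, sub_self, sign_zero, eq_comm, sign_eq_zero_iff] at this
      exact h (sub_eq_zero.1 this)

/-! ### Looking in a fixed direction -/

/-- Finitely many affine functions of one variable have constant signs on some interval
`(0, ε]`, and those that vanish somewhere on it vanish identically. -/
theorem exists_forall_sign_eq {κ : Type*} [Finite κ] (a b : κ → ℝ) :
    ∃ ε > 0, ∀ k, ∀ s ∈ Ioc (0 : ℝ) ε, ∀ t ∈ Ioc (0 : ℝ) ε,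
      SignType.sign (a k + b k * s) = SignType.sign (a k + b k * t) ∧
      (a k + b k * s = 0 → a k = 0 ∧ b k = 0) := by
  have key : ∀ k, ∃ σ : SignType, ∀ᶠ s in 𝓝[>] (0 : ℝ), SignType.sign (a k + b k * s) = σ ∧
      (a k + b k * s = 0 → a k = 0 ∧ b k = 0) := by
    intro k
    by_cases h0 : a k ≠ 0 ∨ b k ≠ 0
    · rcases lt_trichotomy (a k) 0 with ha | ha | ha
      · refine ⟨-1, ?_⟩
        have : ContinuousAt (fun t : ℝ => a k + b k * t) 0 := by fun_prop
        filter_upwards [(this.eventually_lt_const (by simpa using ha)).filter_mono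
          nhdsWithin_le_nhds] with s hs
        exact ⟨sign_neg hs, fun h => absurd h hs.ne⟩
      · have hb := h0.resolve_left (not_not.2 ha)
        refine ⟨SignType.sign (b k), ?_⟩
        filter_upwards [self_mem_nhdsWithin] with s hs
        have hs' : 0 < s := hs
        refine ⟨by rw [ha, zero_add, sign_mul, sign_pos hs', mul_one], fun h => ?_⟩
        rw [ha, zero_add] at h
        exact absurd h (mul_ne_zero hb hs'.ne')
      · refine ⟨1, ?_⟩
        have : ContinuousAt (fun t : ℝ => a k + b k * t) 0 := by fun_prop
        filter_upwards [(this.eventually_const_lt (by simpa using ha)).filter_mono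
          nhdsWithin_le_nhds] with s hs
        exact ⟨sign_pos hs, fun h => absurd h hs.ne'⟩
    · push Not at h0
      exact ⟨0, Eventually.of_forall fun s => ⟨by simp [h0], fun _ => h0⟩⟩
  choose σ hσ using key
  obtain ⟨ε, hε, h⟩ := mem_nhdsGT_iff_exists_Ioc_subset.1 (eventually_all.2 hσ)
  exact ⟨ε, hε, fun k s hs t ht => ⟨((h hs k).1).trans ((h ht k).1).symm, (h hs k).2⟩⟩

/-- Given two equally ordered finite families of reals, a real can be placed relative to the first
family as another one is placed relative to the second. -/
theorem exists_same_position {κ : Type*} [Finite κ] (H H' : κ → ℝ)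
    (h : ∀ i j, H' i < H' j → H i < H j) (h' : ∀ i j, H' i = H' j → H i = H j) (u : ℝ) :
    ∃ u', ∀ i, (H' i < u → H i < u') ∧ (u < H' i → u' < H i) ∧ (u = H' i → u' = H i) := by
  classical
  have := Fintype.ofFinite κ
  by_cases hu : ∃ i, u = H' i
  · obtain ⟨i, rfl⟩ := hu
    exact ⟨H i, fun j => ⟨h j i, h i j, h' i j⟩⟩
  · push Not at hu
    obtain ⟨m, hm1, hm2⟩ := Order.exists_between_finsets
      ((Finset.univ.filter fun i => H' i < u).image H)
      ((Finset.univ.filter fun i => u < H' i).image H) (by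
        simp only [Finset.mem_image, Finset.mem_filter, Finset.mem_univ, true_and]
        rintro _ ⟨i, hi, rfl⟩ _ ⟨j, hj, rfl⟩
        exact h i j (hi.trans hj))
    refine ⟨m, fun i => ⟨fun hi => hm1 _ ?_, fun hi => hm2 _ ?_, fun hi => absurd hi (hu i)⟩⟩ <;>
    · simp only [Finset.mem_image, Finset.mem_filter, Finset.mem_univ, true_and]
      exact ⟨i, hi, rfl⟩

/-- A non-empty open set contains a point at which given non-zero functionals differ from their
values at `x`. -/
theorem exists_mem_open_forall_ne {κ : Type*} [Finite κ] (ψ : κ → E3 →L[ℝ] ℝ) (hψ : ∀ k, ψ k ≠ 0)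
    {O : Set E3} (hO : IsOpen O) (hne : O.Nonempty) (x : E3) :
    ∃ q ∈ O, ∀ k, ψ k (q - x) ≠ 0 := by
  obtain ⟨q, hq⟩ := hne
  obtain ⟨w, -, hw⟩ := exists_forall_ne_zero ⊤ ψ fun k => by
    by_contra h
    push Not at h
    exact hψ k (ContinuousLinearMap.ext fun w => h w trivial)
  have ev1 : ∀ᶠ t in 𝓝[>] (0 : ℝ), ∀ k, ψ k (q - x) + ψ k w * t ≠ 0 :=
    eventually_all.2 fun k => eventually_affine_ne _ _ (Or.inr (hw k))
  have ev2 : ∀ᶠ t in 𝓝[>] (0 : ℝ), q + t • w ∈ O := by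
    have : ContinuousAt (fun t : ℝ => q + t • w) 0 := by fun_prop
    exact (this.eventually_mem (hO.mem_nhds (by simpa using hq))).filter_mono nhdsWithin_le_nhds
  obtain ⟨t, ht1, ht2⟩ := (ev1.and ev2).exists
  refine ⟨_, ht2, fun k h => ht1 k ?_⟩
  rw [← h, add_sub_right_comm, map_add, map_smul, smul_eq_mul, mul_comm t]

/-- Going from `q` in direction `e`, one leaves a compact set at a well-defined first time. -/
theorem exists_exit_time {P : Set E3} (hP : IsCompact P) {q e : E3} (hq : q ∈ interior P)
    (he : e ≠ 0) :
    ∃ u : ℝ, 0 < u ∧ q + u • e ∈ frontier P ∧ ∀ t ∈ Icc (0 : ℝ) u, q + t • e ∈ P := by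
  have hcl := hP.isClosed
  set B := {u : ℝ | 0 ≤ u ∧ q + u • e ∉ P} with hB
  have hBne : B.Nonempty := by
    obtain ⟨R, hR⟩ := hP.isBounded.subset_closedBall q
    have hen : 0 < ‖e‖ := norm_pos_iff.2 he
    refine ⟨(|R| + 1) / ‖e‖, by positivity, fun h => ?_⟩
    have := hR h
    rw [mem_closedBall, dist_eq_norm, add_sub_cancel_left, norm_smul,
      Real.norm_of_nonneg (by positivity), div_mul_cancel₀ _ hen.ne'] at this
    linarith [le_abs_self R]
  have hBbdd : BddBelow B := ⟨0, fun u hu => hu.1⟩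
  set u₀ := sInf B
  have hu0 : 0 ≤ u₀ := le_csInf hBne fun u hu => hu.1
  have hlt : ∀ t, 0 ≤ t → t < u₀ → q + t • e ∈ P := fun t h0 ht => by
    by_contra h
    exact notMem_of_lt_csInf ht hBbdd ⟨h0, h⟩
  have hcont : Continuous fun t : ℝ => q + t • e := by fun_prop
  have hclos : q + u₀ • e ∈ closure Pᶜ :=
    map_mem_closure (f := fun t : ℝ => q + t • e) hcont (csInf_mem_closure hBne hBbdd)
      fun u hu => hu.2
  have hpos : 0 < u₀ := by
    refine lt_of_le_of_ne hu0 fun h => ?_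
    rw [← h, zero_smul, add_zero, closure_compl] at hclos
    exact hclos hq
  have hmem : q + u₀ • e ∈ P := by
    refine hcl.mem_of_tendsto (b := 𝓝[<] u₀)
      (hcont.continuousAt.tendsto.mono_left nhdsWithin_le_nhds) ?_
    filter_upwards [Ioo_mem_nhdsLT hpos] with t ht
    exact hlt t ht.1.le ht.2
  refine ⟨u₀, hpos, ?_, fun t ht => ?_⟩
  · rw [frontier_eq_closure_inter_closure]
    exact ⟨subset_closure hmem, hclos⟩
  · rcases ht.2.lt_or_eq with h | h
    · exact hlt t ht.1 h
    · rw [h]; exact hmem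

/-- Every point `x` of `P` sees a generic boundary point `y` at which the direction `e` leaves `P`.
The point `y` is reached by moving from `x` a little in a generic direction `d` and then along `e`
up to the first exit. The heights at which the half-plane spanned by `d` and `e` at `x` meets the
planes are affine functions of the distance from `x`, in constant order close to `x`; so the
region below the exit height is star-shaped about `x`. -/
theorem exists_visible_exit {ι : Type*} [Finite ι] {φ : ι → E3 →L[ℝ] ℝ} {b : ι → ℝ}
    (hφ : ∀ i, φ i ≠ 0) {P : Set E3} (hP : SignDetermined φ b P) (hcpt : IsCompact P)
    {T : Set E3} (hTP : T ⊆ P) (hT : Convex ℝ T) (hTi : (interior T).Nonempty) {x e : E3}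
    (hx : x ∈ T) (he : e ≠ 0) :
    ∃ y i₀, segment ℝ x y ⊆ P ∧ y ∈ frontier P ∧ φ i₀ y = b i₀ ∧ φ i₀ e ≠ 0 ∧
      (∀ i, φ i y = b i → plane (φ i) (b i) = plane (φ i₀) (b i₀)) ∧
      ∀ᶠ t in 𝓝[>] (0 : ℝ), y - t • e ∈ P := by
  -- choose the direction `d`
  let Ψ : ι ⊕ ι × ι → E3 →L[ℝ] ℝ :=
    Sum.elim φ fun p => (φ p.1 e)⁻¹ • φ p.1 - (φ p.2 e)⁻¹ • φ p.2
  obtain ⟨q₁, hq₁, hgen⟩ := exists_mem_open_forall_ne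
    (fun k : {k : ι ⊕ ι × ι // Ψ k ≠ 0} => Ψ k.1) (fun k => k.2) isOpen_interior hTi x
  set d := q₁ - x with hd
  have hφd : ∀ i, φ i d ≠ 0 := fun i => hgen ⟨Sum.inl i, hφ i⟩
  have hμd : ∀ i j, (φ i e)⁻¹ * φ i d = (φ j e)⁻¹ * φ j d →
      (φ i e)⁻¹ • φ i = (φ j e)⁻¹ • φ j := fun i j h => by
    by_contra hne
    refine hgen ⟨Sum.inr (i, j), sub_ne_zero.2 hne⟩ ?_
    simp [Ψ, h]
  -- heights above `x + s • d`, with `none` standing for the height zero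
  let α : Option ι → ℝ := fun o => o.elim 0 fun i => -(φ i e)⁻¹ * (φ i x - b i)
  let β : Option ι → ℝ := fun o => o.elim 0 fun i => -(φ i e)⁻¹ * φ i d
  obtain ⟨ε₁, hε₁, hs1⟩ := exists_forall_sign_eq (fun i => φ i x - b i) (fun i => φ i d)
  obtain ⟨ε₂, hε₂, hs2⟩ := exists_forall_sign_eq
    (fun p : Option ι × Option ι => α p.1 - α p.2) (fun p => β p.1 - β p.2)
  set s₀ := min (min ε₁ ε₂) 1 with hs₀
  have hs₀pos : 0 < s₀ := by simp [hs₀, hε₁.lt, hε₂.lt]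
  have hle1 : s₀ ≤ ε₁ := (min_le_left _ _).trans (min_le_left _ _)
  have hle2 : s₀ ≤ ε₂ := (min_le_left _ _).trans (min_le_right _ _)
  have hqi : x + s₀ • d ∈ interior P := interior_mono hTP
    (hT.add_smul_sub_mem_interior hx hq₁ ⟨hs₀pos, min_le_right _ _⟩)
  obtain ⟨u₀, hu₀, hyf, hup⟩ := exists_exit_time hcpt hqi he
  set y := x + s₀ • d + u₀ • e with hy
  have hval : ∀ i s u, φ i (x + s • d + u • e) - b i =
      (φ i x - b i + φ i d * s) + φ i e * u := fun i s u => by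
    simp only [map_add, map_smul, smul_eq_mul]; ring
  have hheight : ∀ i s u, φ i e ≠ 0 → φ i (x + s • d + u • e) - b i =
      φ i e * (u - (α (some i) + β (some i) * s)) := fun i s u h => by
    rw [hval]
    simp only [α, β, Option.elim_some]
    field_simp
    ring
  have hnv : ∀ i, φ i y = b i → φ i e ≠ 0 := by
    intro i hi h0
    have h1 := hval i s₀ u₀
    rw [← hy, hi, sub_self, h0, zero_mul, add_zero] at h1
    exact hφd i ((hs1 i s₀ ⟨hs₀pos, hle1⟩ s₀ ⟨hs₀pos, hle1⟩).2 h1.symm).2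
  have hheq : ∀ i, φ i y = b i → u₀ = α (some i) + β (some i) * s₀ := by
    intro i hi
    have h1 := hheight i s₀ u₀ (hnv i hi)
    rw [← hy, hi, sub_self, eq_comm, mul_eq_zero] at h1
    exact sub_eq_zero.1 (h1.resolve_left (hnv i hi))
  obtain ⟨i₀, hi₀⟩ := exists_eq_of_mem_frontier hP hcpt.isClosed hyf
  have hu₀eq := hheq i₀ hi₀
  refine ⟨y, i₀, ?_, hyf, hi₀, hnv i₀ hi₀, ?_, ?_⟩
  · -- the exit height at distance zero is non-negative
    have hα : 0 ≤ α (some i₀) := by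
      by_contra hneg
      push Not at hneg
      have hcont : ContinuousAt (fun s : ℝ => α (some i₀) + β (some i₀) * s) 0 := by fun_prop
      obtain ⟨s, hs, hs'⟩ := (((hcont.eventually_lt_const (by simpa using hneg)).filter_mono
        nhdsWithin_le_nhds).and (Ioc_mem_nhdsGT hs₀pos)).exists
      have h1 := (hs2 (some i₀, none) s ⟨hs'.1, hs'.2.trans hle2⟩ s₀ ⟨hs₀pos, hle2⟩).1
      simp only [α, β, Option.elim_none, sub_zero] at h1
      rw [sign_neg hs, sign_pos (by rw [← hu₀eq]; exact hu₀)] at h1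
      exact absurd h1 (by decide)
    rintro _ ⟨c₁, c₂, hc₁, hc₂, hc, rfl⟩
    rcases hc₂.eq_or_lt with h0 | hpos
    · rw [← h0, add_zero] at hc
      rw [hc, ← h0, one_smul, zero_smul, add_zero]
      exact hTP hx
    have hc₂1 : c₂ ≤ 1 := by linarith
    have hz : c₁ • x + c₂ • y = x + (c₂ * s₀) • d + (c₂ * u₀) • e := by
      rw [hy, eq_sub_of_add_eq hc]
      module
    rw [hz]
    set s := c₂ * s₀ with hs
    have hspos : 0 < s := by positivity
    have hsle : s ≤ s₀ := by nlinarith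
    have hord := fun i j => (hs2 (i, j) s ⟨hspos, hsle.trans hle2⟩ s₀ ⟨hs₀pos, hle2⟩).1
    have hdiff : ∀ (i j : Option ι) (t : ℝ), (α i - α j) + (β i - β j) * t =
        (α i + β i * t) - (α j + β j * t) := fun i j t => by ring
    simp only [hdiff] at hord
    obtain ⟨u', hu'⟩ := exists_same_position (fun i => α i + β i * s₀) (fun i => α i + β i * s)
      (fun i j h => by
        have := hord i j
        rw [sign_neg (by linarith), eq_comm, sign_eq_neg_one_iff] at this
        linarith)
      (fun i j h => by
        have := hord i j
        rw [sub_eq_zero.2 h, sign_zero, eq_comm, sign_eq_zero_iff] at this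
        linarith) (c₂ * u₀)
    have hu'0 : 0 ≤ u' := by
      have := hu' none
      simp only [α, β, Option.elim_none, zero_mul, add_zero] at this
      rcases (mul_nonneg hc₂ hu₀.le).lt_or_eq with h | h
      · exact (this.1 h).le
      · exact (this.2.2 h.symm).ge
    have hu'le : u' ≤ u₀ := by
      have h1 := hu' (some i₀)
      have h2 : c₂ * u₀ ≤ α (some i₀) + β (some i₀) * s := by
        rw [hu₀eq, hs]
        nlinarith
      simp only [← hu₀eq] at h1
      rcases h2.lt_or_eq with h | h
      · exact (h1.2.1 h).le
      · exact (h1.2.2 h).le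
    refine hP _ _ (fun i => ?_) (hup u' ⟨hu'0, hu'le⟩)
    by_cases hie : φ i e = 0
    · rw [hval, hval, hie, zero_mul, zero_mul, add_zero, add_zero]
      exact (hs1 i s₀ ⟨hs₀pos, hle1⟩ s ⟨hspos, hsle.trans hle1⟩).1
    · rw [hheight i _ _ hie, hheight i _ _ hie, sign_mul, sign_mul]
      congr 1
      have h1 := hu' (some i)
      rcases lt_trichotomy (c₂ * u₀) (α (some i) + β (some i) * s) with h | h | h
      · rw [sign_neg (sub_neg.2 h), sign_neg (sub_neg.2 (h1.2.1 h))]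
      · rw [sub_eq_zero.2 h, sub_eq_zero.2 (h1.2.2 h)]
      · rw [sign_pos (sub_pos.2 h), sign_pos (sub_pos.2 (h1.1 h))]
  · intro i hi
    have hzero : (α (some i) - α (some i₀)) + (β (some i) - β (some i₀)) * s₀ = 0 := by
      have := hheq i hi
      linarith
    have hβ := ((hs2 (some i, some i₀) s₀ ⟨hs₀pos, hle2⟩ s₀ ⟨hs₀pos, hle2⟩).2 hzero).2
    have h2 : (φ i e)⁻¹ * φ i d = (φ i₀ e)⁻¹ * φ i₀ d := by
      simp only [β, Option.elim_some] at hβ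
      linarith
    have h3 := hμd i i₀ h2
    have hie := inv_ne_zero (hnv i hi)
    have hie₀ := inv_ne_zero (hnv i₀ hi₀)
    ext z
    have h4 : (φ i e)⁻¹ * φ i (z - y) = (φ i₀ e)⁻¹ * φ i₀ (z - y) :=
      congrArg (fun ψ : E3 →L[ℝ] ℝ => ψ (z - y)) h3
    have h5 : φ i (z - y) = 0 ↔ φ i₀ (z - y) = 0 := by
      constructor <;> intro h <;> rw [h, mul_zero] at h4
      · exact (mul_eq_zero.1 h4.symm).resolve_left hie₀
      · exact (mul_eq_zero.1 h4).resolve_left hie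
    rwa [map_sub, map_sub, hi, hi₀, sub_eq_zero, sub_eq_zero] at h5
  · filter_upwards [Ioo_mem_nhdsGT hu₀] with t ht
    have := hup (u₀ - t) ⟨by linarith [ht.2], by linarith [ht.1]⟩
    rwa [sub_smul, ← add_sub_assoc] at this

/-- Every point of a polyhedron sees a point of some open face through which the direction `e`
leaves the polyhedron. -/
theorem exists_visible_face {P : Set E3} (hP : IsPolyhedron P) {e : E3} (he : e ≠ 0) {x : E3}
    (hx : x ∈ P) :
    ∃ F ∈ faces P, ∃ q ∈ intrinsicInterior ℝ F, segment ℝ x q ⊆ P ∧ e ∉ vectorSpan ℝ F ∧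
      ∀ᶠ t in 𝓝[>] (0 : ℝ), q - t • e ∈ interior P := by
  obtain ⟨⟨ι, _, φ, b, hφ, hsd⟩, hcpt, hconv⟩ := exists_signDetermined hP.union_tetrahedra
  obtain ⟨T, hTP, hxT, hT, hTi⟩ := hconv x hx
  obtain ⟨y, i₀, hseg, hyf, hyi, hei, hgen, hev⟩ :=
    exists_visible_exit hφ hsd hcpt hTP hT hTi hxT he
  obtain ⟨r, hr, hdisc, hint⟩ := exists_ball_of_generic hsd hcpt.isClosed hyf hgen
  obtain ⟨F, hF, hyF, hFpl⟩ :=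
    exists_maximal_planarRegion isClosed_frontier (hφ i₀) hyi hr hdisc
  refine ⟨F, hF, y, hyF, hseg, fun h => hei (vectorSpan_le_ker hFpl h), ?_⟩
  have hcont : ContinuousAt (fun t : ℝ => y - t • e) 0 := by fun_prop
  filter_upwards [hev, self_mem_nhdsWithin, (hcont.eventually_mem
    (isOpen_ball.mem_nhds (by simpa using hr : y - (0 : ℝ) • e ∈ ball y r))).filter_mono
      nhdsWithin_le_nhds] with t ht ht0 htb
  refine hint _ htb ht fun h => ?_
  have h1 : φ i₀ (y - t • e) = b i₀ := h
  rw [map_sub, map_smul, hyi, smul_eq_mul, sub_eq_self, mul_eq_zero] at h1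
  exact h1.elim (ne_of_gt ht0) hei

/-! ### The boundary lies on one side of each open face -/

/-- In a closed surface in space, relatively open subsets of planes are open. -/
theorem exists_ball_inter_subset_of_relOpen {S : Set E3}
    (hS : Nonempty (ChartedSpace (EuclideanSpace ℝ (Fin 2)) S)) {φ : E3 →L[ℝ] ℝ} (hφ : φ ≠ 0)
    {b : ℝ} {U : Set E3} (hU : RelOpen φ b U) (hUS : U ⊆ S) {q : E3} (hq : q ∈ U) :
    ∃ ε > 0, S ∩ ball q ε ⊆ U := by
  obtain ⟨cs⟩ := hS
  set qS : S := ⟨q, hUS hq⟩ with hqS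
  let c := chartAt (EuclideanSpace ℝ (Fin 2)) qS
  have hqc : qS ∈ c.source := mem_chart_source _ qS
  have hrank : Module.finrank ℝ ℂ = Module.finrank ℝ (LinearMap.ker φ.toLinearMap) := by
    rw [finrank_ker hφ, Complex.finrank_real_complex]
  let L₀ := (LinearEquiv.ofFinrankEq ℂ (LinearMap.ker φ.toLinearMap) hrank).toContinuousLinearEquiv
  let L : ℂ → E3 := fun z => (L₀ z : E3)
  have hLc : Continuous L := continuous_subtype_val.comp L₀.continuous
  have hL0 : L 0 = 0 := by simp [L]
  have hLinj : Function.Injective L := Subtype.val_injective.comp L₀.injective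
  have hLφ : ∀ z, φ (L z) = 0 := fun z => (L₀ z).2
  obtain ⟨ε, hε, hball⟩ := hU.2 q hq
  obtain ⟨O, hO, hOc⟩ := isOpen_induced_iff.1 c.open_source
  have hqO : q ∈ O := by
    have : qS ∈ ((↑) : S → E3) ⁻¹' O := by rw [hOc]; exact hqc
    exact this
  obtain ⟨δ, hδ, hδb⟩ := Metric.isOpen_iff.1 (hO.inter isOpen_ball) q ⟨hqO, mem_ball_self hε⟩
  obtain ⟨ρ, hρ, hρb⟩ := Metric.continuousAt_iff.1 hLc.continuousAt δ hδ
  set r := ρ / 2 with hr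
  have hr0 : 0 < r := half_pos hρ
  let κ : ℂ → E3 := fun z => q + L ((r : ℂ) * z)
  have hκc : Continuous κ := continuous_const.add (hLc.comp (continuous_const.mul continuous_id))
  have hκinj : Function.Injective κ := fun z w h => by
    have h1 := hLinj (add_left_cancel h)
    exact mul_left_cancel₀ (by exact_mod_cast hr0.ne') h1
  have hκ0 : κ 0 = q := by simp [κ, hL0]
  have hκ : ∀ z ∈ closedBall (0 : ℂ) 1, κ z ∈ O ∧ κ z ∈ U := by
    intro z hz
    rw [mem_closedBall_zero_iff] at hz
    have h1 : dist ((r : ℂ) * z) 0 < ρ := by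
      rw [dist_zero_right, norm_mul, Complex.norm_real, Real.norm_of_nonneg hr0.le]
      nlinarith
    have h2 := hρb h1
    rw [hL0, dist_zero_right] at h2
    have h3 : κ z ∈ ball q δ := by
      rw [mem_ball, dist_eq_norm]; simpa [κ] using h2
    exact ⟨(hδb h3).1, hball ⟨(hδb h3).2, add_mem_plane (hU.1 hq) (hLφ _)⟩⟩
  let toC : EuclideanSpace ℝ (Fin 2) → ℂ := Complex.orthonormalBasisOneI.repr.symm
  have htoC : Continuous toC := Complex.orthonormalBasisOneI.repr.symm.continuous
  have htoCi : Function.Injective toC := Complex.orthonormalBasisOneI.repr.symm.injective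
  classical
  let f : ℂ → ℂ := fun z => if h : κ z ∈ S then toC (c ⟨κ z, h⟩) else 0
  have hsrc : ∀ s : S, (s : E3) ∈ O → s ∈ c.source := fun s hs => by rw [← hOc]; exact hs
  have hfz : ∀ z (hz : z ∈ closedBall (0 : ℂ) 1), f z = toC (c ⟨κ z, hUS (hκ z hz).2⟩) :=
    fun z hz => dif_pos (hUS (hκ z hz).2)
  have hfc : ContinuousOn f (closedBall 0 1) := by
    rw [continuousOn_iff_continuous_domRestrict]
    have e : (closedBall (0 : ℂ) 1).domRestrict f =
        fun z : closedBall (0 : ℂ) 1 => toC (c ⟨κ z, hUS (hκ z z.2).2⟩) :=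
      funext fun z => hfz z z.2
    rw [e]
    refine htoC.comp (c.continuousOn.comp_continuous ?_ fun z => hsrc _ (hκ z z.2).1)
    exact Continuous.subtype_mk (hκc.comp continuous_subtype_val) _
  have hfi : InjOn f (closedBall 0 1) := by
    intro z hz w hw h
    rw [hfz z hz, hfz w hw] at h
    have h1 := c.injOn (hsrc _ (hκ z hz).1) (hsrc _ (hκ w hw).1) (htoCi h)
    exact hκinj (congrArg Subtype.val h1)
  have hinv := image_closedBall_mem_nhds f hfc hfi
  have hf0 : f 0 = toC (c qS) := by
    rw [hfz 0 (by simp)]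
    congr 2
    exact Subtype.ext hκ0
  rw [hf0] at hinv
  have hcont : ContinuousAt (fun s => toC (c s)) qS :=
    htoC.continuousAt.comp (c.continuousAt hqc)
  obtain ⟨η, hη, hηb⟩ := Metric.mem_nhds_iff.1
    (inter_mem (hcont hinv) (c.open_source.mem_nhds hqc))
  refine ⟨η, hη, fun s hs => ?_⟩
  obtain ⟨⟨z, hz, hzs⟩, hs2⟩ := hηb (show (⟨s, hs.1⟩ : S) ∈ ball qS η from hs.2)
  rw [hfz z hz] at hzs
  have h1 := c.injOn (hsrc _ (hκ z hz).1) hs2 (htoCi hzs)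
  have h2 : κ z = s := congrArg Subtype.val h1
  exact h2 ▸ (hκ z hz).2

/-- If the boundary of `P` in a ball is contained in a plane, then an open half-ball that meets
`P` is contained in the interior of `P`. -/
theorem halfBall_subset_interior {P : Set E3} {φ : E3 →L[ℝ] ℝ} {b r a : ℝ} {q : E3}
    (h : frontier P ∩ ball q r ⊆ plane φ b) {z : E3} (hz : z ∈ ball q r) (hzP : z ∈ P)
    (hza : 0 < (φ z - b) * a) :
    ball q r ∩ {v | 0 < (φ v - b) * a} ⊆ interior P := by
  have hconv : Convex ℝ {v : E3 | 0 < (φ v - b) * a} := by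
    have : {v : E3 | 0 < (φ v - b) * a} = {v | b * a < (a • φ) v} := by
      ext v
      simp only [mem_ofPred_eq, _root_.smul_apply, smul_eq_mul]
      constructor <;> intro h <;> nlinarith
    rw [this]
    exact convex_halfSpace_gt (a • φ).toLinearMap.isLinear _
  have hpre := ((convex_ball q r).inter hconv).isPreconnected
  have hnf : ∀ v ∈ ball q r ∩ {v | 0 < (φ v - b) * a}, v ∉ frontier P := by
    intro v hv hvf
    have h1 : φ v = b := h ⟨hvf, hv.1⟩
    have h2 := hv.2
    simp only [mem_ofPred_eq, h1, sub_self, zero_mul, lt_self_iff_false] at h2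
  refine hpre.subset_left_of_subset_union isOpen_interior isClosed_closure.isOpen_compl
    (disjoint_compl_right.mono_left interior_subset_closure) (fun v hv => ?_) ⟨z, ⟨hz, hza⟩, ?_⟩
  · by_contra hv'
    rw [mem_union, not_or, notMem_compl_iff] at hv'
    exact hnf v hv ⟨hv'.2, hv'.1⟩
  · by_contra hzi
    exact hnf z ⟨hz, hza⟩ ⟨subset_closure hzP, hzi⟩

theorem eventually_mem_of_isOpen {O : Set E3} (hO : IsOpen O) {q : E3} (hq : q ∈ O) (e : E3) :
    ∀ᶠ t in 𝓝[>] (0 : ℝ), q + t • e ∈ O := by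
  have hcont : ContinuousAt (fun t : ℝ => q + t • e) 0 := by fun_prop
  exact (hcont.eventually_mem (hO.mem_nhds (by simpa using hq))).filter_mono nhdsWithin_le_nhds

/-- A set that is the closure of its interior and whose boundary is a surface cannot lie below one
point of a connected open piece of its boundary, and above another one. -/
theorem not_both_sides {P : Set E3} (hcl : IsClosed P) (hPi : P ⊆ closure (interior P))
    (hS : Nonempty (ChartedSpace (EuclideanSpace ℝ (Fin 2)) (frontier P)))
    {φ : E3 →L[ℝ] ℝ} {b : ℝ} {U : Set E3} (hU : RelOpen φ b U) (hUS : U ⊆ frontier P)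
    (hconn : IsPreconnected U) {e : E3} (he : φ e ≠ 0) {q q' : E3} (hq : q ∈ U) (hq' : q' ∈ U)
    (h : ∀ᶠ t in 𝓝[>] (0 : ℝ), q + t • e ∈ interior P)
    (h' : ∀ᶠ t in 𝓝[>] (0 : ℝ), q' + t • (-e) ∈ interior P) : False := by
  have hφ : φ ≠ 0 := fun h => he (by simp [h])
  have hloc : ∀ x ∈ U, ∃ r > 0, frontier P ∩ ball x r ⊆ plane φ b := fun x hx => by
    obtain ⟨r, hr, hb⟩ := exists_ball_inter_subset_of_relOpen hS hφ hU hUS hx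
    exact ⟨r, hr, hb.trans hU.1⟩
  -- the half-ball at `x` on the side of `v` is contained in `P` if `x + t • v` is in `P`
  have side : ∀ v : E3, φ v ≠ 0 → ∀ x ∈ U, ∀ r, 0 < r → frontier P ∩ ball x r ⊆ plane φ b →
      (∀ᶠ t in 𝓝[>] (0 : ℝ), x + t • v ∈ interior P) →
      ball x r ∩ {w | 0 < (φ w - b) * φ v} ⊆ interior P := by
    intro v hv x hx r hr hb hev
    obtain ⟨t, ⟨ht, htb⟩, ht0⟩ := ((hev.and (eventually_mem_of_isOpen isOpen_ball
      (mem_ball_self hr) v)).and self_mem_nhdsWithin).exists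
    refine halfBall_subset_interior hb htb (interior_subset ht) ?_
    have hxb : φ x = b := hU.1 hx
    have ht0' : 0 < t := ht0
    rw [map_add, map_smul, hxb, add_sub_cancel_left, smul_eq_mul, mul_assoc]
    exact mul_pos ht0' (mul_self_pos.2 hv)
  have spread : ∀ v : E3, φ v ≠ 0 → ∀ x ∈ U,
      (∀ᶠ t in 𝓝[>] (0 : ℝ), x + t • v ∈ interior P) → ∀ᶠ x' in 𝓝[U] x,
      ∀ᶠ t in 𝓝[>] (0 : ℝ), x' + t • v ∈ interior P := by
    intro v hv x hx hev
    obtain ⟨r, hr, hb⟩ := hloc x hx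
    have hsub := side v hv x hx r hr hb hev
    filter_upwards [self_mem_nhdsWithin, mem_nhdsWithin_of_mem_nhds (ball_mem_nhds x hr)]
      with x' hx' hxb
    filter_upwards [eventually_mem_of_isOpen isOpen_ball hxb v, self_mem_nhdsWithin] with t ht ht0
    refine hsub ⟨ht, ?_⟩
    have hxb : φ x' = b := hU.1 hx'
    have ht0' : 0 < t := ht0
    rw [mem_ofPred_eq, map_add, map_smul, hxb, add_sub_cancel_left, smul_eq_mul, mul_assoc]
    exact mul_pos ht0' (mul_self_pos.2 hv)
  have hne : φ (-e) ≠ 0 := by simpa using he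
  have off : ∀ O : Set E3, IsOpen O → O.Nonempty → ∃ z ∈ O, φ z ≠ b := by
    rintro O hO ⟨z, hz⟩
    obtain ⟨t, ht1, ht2⟩ := ((eventually_mem_of_isOpen hO hz e).and
      (eventually_affine_ne (φ z - b) (φ e) (Or.inr he))).exists
    refine ⟨_, ht1, fun h => ht2 ?_⟩
    rw [← h, map_add, map_smul, smul_eq_mul]; ring
  have notboth : ∀ x ∈ U, (∀ᶠ t in 𝓝[>] (0 : ℝ), x + t • e ∈ interior P) →
      ¬ ∀ᶠ t in 𝓝[>] (0 : ℝ), x + t • (-e) ∈ interior P := by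
    intro x hx h1 h2
    obtain ⟨r, hr, hb⟩ := hloc x hx
    have s1 := side e he x hx r hr hb h1
    have s2 := side (-e) hne x hx r hr hb h2
    have hxf := hUS hx
    rw [frontier_eq_closure_inter_closure] at hxf
    obtain ⟨z, hz1, hz2⟩ := mem_closure_iff.1 hxf.2 _ isOpen_ball (mem_ball_self hr)
    obtain ⟨w, ⟨hw1, hw2⟩, hwb⟩ := off _ (isOpen_ball.inter hcl.isOpen_compl) ⟨z, hz1, hz2⟩
    refine hw2 ?_
    have hne0 : (φ w - b) * φ e ≠ 0 := mul_ne_zero (sub_ne_zero.2 hwb) he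
    rcases lt_or_gt_of_ne hne0 with hlt | hgt
    · refine interior_subset (s2 ⟨hw1, ?_⟩)
      rw [mem_ofPred_eq, map_neg, mul_neg]
      linarith
    · exact interior_subset (s1 ⟨hw1, hgt⟩)
  have one : ∀ x ∈ U, (¬ ∀ᶠ t in 𝓝[>] (0 : ℝ), x + t • e ∈ interior P) →
      ∀ᶠ t in 𝓝[>] (0 : ℝ), x + t • (-e) ∈ interior P := by
    intro x hx hnot
    obtain ⟨r, hr, hb⟩ := hloc x hx
    obtain ⟨z, hz1, hz2⟩ := mem_closure_iff.1 (hPi (hcl.frontier_subset (hUS hx))) _ isOpen_ball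
      (mem_ball_self hr)
    obtain ⟨w, ⟨hw1, hw2⟩, hwb⟩ := off _ (isOpen_ball.inter isOpen_interior) ⟨z, hz1, hz2⟩
    have hxb : φ x = b := hU.1 hx
    have goto : ∀ v : E3, 0 < (φ w - b) * φ v →
        ∀ᶠ t in 𝓝[>] (0 : ℝ), x + t • v ∈ interior P := by
      intro v hv
      have hsub := halfBall_subset_interior hb hw1 (interior_subset hw2) hv
      filter_upwards [eventually_mem_of_isOpen isOpen_ball (mem_ball_self hr) v,
        self_mem_nhdsWithin] with t ht ht0
      refine hsub ⟨ht, ?_⟩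
      have ht0' : 0 < t := ht0
      have hv0 : φ v ≠ 0 := fun h => by simp [h] at hv
      rw [mem_ofPred_eq, map_add, map_smul, hxb, add_sub_cancel_left, smul_eq_mul, mul_assoc]
      exact mul_pos ht0' (mul_self_pos.2 hv0)
    have hne0 : (φ w - b) * φ e ≠ 0 := mul_ne_zero (sub_ne_zero.2 hwb) he
    rcases lt_or_gt_of_ne hne0 with hlt | hgt
    · refine goto _ ?_
      rw [map_neg, mul_neg]
      linarith
    · exact absurd (goto e hgt) hnot
  have const := hconn.induction₂
    (fun x y => (∀ᶠ t in 𝓝[>] (0 : ℝ), x + t • e ∈ interior P) ↔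
      ∀ᶠ t in 𝓝[>] (0 : ℝ), y + t • e ∈ interior P)
    (fun x hx => by
      by_cases hA : ∀ᶠ t in 𝓝[>] (0 : ℝ), x + t • e ∈ interior P
      · filter_upwards [spread e he x hx hA] with y hy
        exact ⟨fun _ => hy, fun _ => hA⟩
      · filter_upwards [spread (-e) hne x hx (one x hx hA), self_mem_nhdsWithin] with y hy hyU
        exact ⟨fun h => absurd h hA, fun h => absurd hy (notboth y hyU h)⟩)
    (fun x y z _ _ _ h1 h2 => h1.trans h2) (fun x y _ _ h => h.symm) hq hq'
  exact notboth q' hq' (const.1 h) h'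

/-! ### Half of the faces transversal to a direction guard the polyhedron -/

/-- The faces through which the direction `e` leaves the polyhedron. -/
def exitFaces (P : Set E3) (e : E3) : Set (Set E3) :=
  {F ∈ faces P | e ∉ vectorSpan ℝ F ∧ ∃ q ∈ intrinsicInterior ℝ F,
    ∀ᶠ t in 𝓝[>] (0 : ℝ), q - t • e ∈ interior P}

theorem openFaceGuards_exitFaces {P : Set E3} (hP : IsPolyhedron P) {e : E3} (he : e ≠ 0) :
    OpenFaceGuards P (exitFaces P e) := by
  have hcl : IsClosed P := (exists_signDetermined hP.union_tetrahedra).2.1.isClosed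
  refine ⟨fun F hF => hF.1, Set.ext fun x => ⟨?_, fun hx => ?_⟩⟩
  · rintro ⟨y, -, hy⟩
    have := hy x (right_mem_segment ℝ y x)
    rwa [hcl.isOpen_compl.interior_eq, notMem_compl_iff] at this
  · obtain ⟨F, hF, q, hq, hseg, heF, hev⟩ := exists_visible_face hP he hx
    refine ⟨q, mem_biUnion (show F ∈ exitFaces P e from ⟨hF, heF, q, hq, hev⟩) hq, fun z hz => ?_⟩
    rw [hcl.isOpen_compl.interior_eq, notMem_compl_iff]
    exact hseg (segment_symm ℝ q x ▸ hz)

theorem disjoint_exitFaces {P : Set E3} (hP : IsPolyhedron P) (e : E3) :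
    Disjoint (exitFaces P e) (exitFaces P (-e)) := by
  obtain ⟨-, hcpt, hconv⟩ := exists_signDetermined hP.union_tetrahedra
  have hPi : P ⊆ closure (interior P) := fun x hx => by
    obtain ⟨T, hTP, hxT, hT, hTi⟩ := hconv x hx
    have h1 : x ∈ closure T := subset_closure hxT
    rw [← hT.closure_interior_eq_closure_of_nonempty_interior hTi] at h1
    exact closure_mono (interior_mono hTP) h1
  rw [Set.disjoint_left]
  rintro F ⟨hF, heF, q, hq, hev⟩ ⟨-, -, q', hq', hev'⟩
  obtain ⟨φ, hφ, b, hFpl⟩ := exists_plane hF.1.planar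
  have hφe : φ e ≠ 0 := fun h => heF (by rw [vectorSpan_eq_ker hφ hFpl hF.1.planar]; exact h)
  refine not_both_sides hcpt.isClosed hPi hP.manifold
    (relOpen_intrinsicInterior hφ hFpl hF.1.planar)
    (intrinsicInterior_subset.trans hF.1.subset) hF.1.connected.isPreconnected hφe hq' hq ?_ ?_
  · simpa [sub_eq_add_neg] using hev'
  · simpa [sub_eq_add_neg] using hev

theorem exists_orthogonal_pair (u v : E3) : ∃ e : E3, e ≠ 0 ∧ inner ℝ u e = 0 ∧ inner ℝ v e = 0 := by
  have h1 := Submodule.finrank_add_finrank_orthogonal (Submodule.span ℝ {u, v})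
  have h2 : Module.finrank ℝ (Submodule.span ℝ ({u, v} : Set E3)) ≤ 2 := by
    classical
    have := finrank_span_finset_le_card (R := ℝ) ({u, v} : Finset E3)
    rw [Finset.coe_insert, Finset.coe_singleton] at this
    exact this.trans Finset.card_le_two
  rw [finrank_euclideanSpace_fin] at h1
  have hne : (Submodule.span ℝ {u, v})ᗮ ≠ ⊥ := by
    intro h
    rw [h, finrank_bot] at h1
    omega
  obtain ⟨e, he, he0⟩ := Submodule.exists_mem_ne_zero_of_ne_bot hne
  rw [Submodule.mem_orthogonal] at he
  exact ⟨e, he0, he u (Submodule.subset_span (by simp)), he v (Submodule.subset_span (by simp))⟩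

theorem mem_vectorSpan_of_orthogonal {S F : Set E3} (hF : IsPlanarRegion S F) {u e : E3}
    (hu : ‖u‖ = 1) (h : ∀ w ∈ vectorSpan ℝ F, inner ℝ u w = 0) (he : inner ℝ u e = 0) :
    e ∈ vectorSpan ℝ F := by
  have hne : innerSL ℝ u ≠ 0 := fun h0 => by
    have : innerSL ℝ u u = 0 := by rw [h0]; rfl
    simp [hu] at this
  have : vectorSpan ℝ F = LinearMap.ker (innerSL ℝ u).toLinearMap :=
    Submodule.eq_of_le_of_finrank_eq h (by rw [hF.planar, finrank_ker hne])
  rw [this]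
  exact he

/-- If at most half of the faces are transversal to some direction `e`, then a quarter of the faces
suffice as open face guards. -/
theorem exists_guards_of_direction {P : Set E3} (hP : IsPolyhedron P) (hfin : (faces P).Finite)
    {e : E3} (he : e ≠ 0) {D : Set (Set E3)} (hD : ∀ F ∈ faces P, F ∉ D → e ∈ vectorSpan ℝ F)
    (hDf : D ⊆ faces P) (hcard : 2 * D.ncard ≤ (faces P).ncard) :
    ∃ G, OpenFaceGuards P G ∧ G.encard ≤ (((faces P).ncard / 4 : ℕ) : ℕ∞) := by
  have hDfin := hfin.subset hDf
  have hsub : ∀ v, (v = e ∨ v = -e) → exitFaces P v ⊆ D := by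
    intro v hv F hF
    by_contra hFD
    have h1 := hD F hF.1 hFD
    refine hF.2.1 ?_
    rcases hv with rfl | rfl
    · exact h1
    · exact neg_mem h1
  have hs1 := hsub e (Or.inl rfl)
  have hs2 := hsub (-e) (Or.inr rfl)
  have h1 := Set.ncard_union_eq (disjoint_exitFaces hP e) (hDfin.subset hs1) (hDfin.subset hs2)
  have h2 := Set.ncard_le_ncard (union_subset hs1 hs2) hDfin
  by_cases hle : (exitFaces P e).ncard ≤ (exitFaces P (-e)).ncard
  · refine ⟨_, openFaceGuards_exitFaces hP he, ?_⟩
    rw [← (hDfin.subset hs1).cast_ncard_eq]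
    exact_mod_cast (show (exitFaces P e).ncard ≤ (faces P).ncard / 4 by omega)
  · refine ⟨_, openFaceGuards_exitFaces hP (neg_ne_zero.2 he), ?_⟩
    rw [← (hDfin.subset hs2).cast_ncard_eq]
    exact_mod_cast (show (exitFaces P (-e)).ncard ≤ (faces P).ncard / 4 by omega)

/-- Sufficiency: pair the four orientations into two pairs; one pair contains at least half of the
faces, and all of these are parallel to a common direction. -/
theorem exists_guards_of_four_oriented {f : ℕ} {P : Set E3} (hP : IsPolyhedron P)
    (hO : IsOriented 4 P) (hf : (faces P).encard = (f : ℕ∞)) :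
    ∃ G : Set (Set E3), OpenFaceGuards P G ∧ G.encard ≤ ((f / 4 : ℕ) : ℕ∞) := by
  have hfin : (faces P).Finite := Set.finite_of_encard_eq_coe hf
  have hfn : (faces P).ncard = f := by rw [Set.ncard, hf]; rfl
  rw [← hfn]
  obtain ⟨u, hu, hOF⟩ := hO
  let D : Set (Set E3) := {F ∈ faces P | ∀ w ∈ vectorSpan ℝ F, inner ℝ (u 0) w = 0} ∪
    {F ∈ faces P | ∀ w ∈ vectorSpan ℝ F, inner ℝ (u 1) w = 0}
  have hDf : D ⊆ faces P := union_subset (fun F hF => hF.1) fun F hF => hF.1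
  have hsum := Set.ncard_sdiff_add_ncard_of_subset hDf hfin
  by_cases hle : 2 * D.ncard ≤ (faces P).ncard
  · obtain ⟨e, he, h2, h3⟩ := exists_orthogonal_pair (u 2) (u 3)
    refine exists_guards_of_direction hP hfin he (D := D) (fun F hF hFD => ?_) hDf hle
    obtain ⟨i, hi⟩ := hOF F hF
    have : i = 2 ∨ i = 3 := by
      fin_cases i
      · exact absurd (Or.inl ⟨hF, hi⟩) hFD
      · exact absurd (Or.inr ⟨hF, hi⟩) hFD
      · exact Or.inl rfl
      · exact Or.inr rfl
    rcases this with rfl | rfl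
    · exact mem_vectorSpan_of_orthogonal hF.1 (hu _) hi h2
    · exact mem_vectorSpan_of_orthogonal hF.1 (hu _) hi h3
  · obtain ⟨e, he, h0, h1⟩ := exists_orthogonal_pair (u 0) (u 1)
    refine exists_guards_of_direction hP hfin he (D := faces P \ D) (fun F hF hFD => ?_)
      sdiff_subset (by omega)
    have hFD' : F ∈ D := by
      by_contra h
      exact hFD ⟨hF, h⟩
    rcases hFD' with h | h
    · exact mem_vectorSpan_of_orthogonal hF.1 (hu _) h.2 h0
    · exact mem_vectorSpan_of_orthogonal hF.1 (hu _) h.2 h1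

/-! ### Boundaries that are locally graphs -/

/-- If `g` grows at least linearly along `v`, its zero set is a graph over a plane. So a set `S`
that agrees with this zero set near `p` has a chart at `p`. -/
theorem exists_chart {S : Set E3} {g : E3 → ℝ} (hg : Continuous g) {v : E3} {δ : ℝ} (hδ : 0 < δ)
    (hmono : ∀ x t, 0 ≤ t → g x + δ * t ≤ g (x + t • v)) {N : Set E3} (hN : IsOpen N)
    (hSN : ∀ x ∈ N, x ∈ S ↔ g x = 0) (p : S) (hp : (p : E3) ∈ N) :
    ∃ c : OpenPartialHomeomorph S (EuclideanSpace ℝ (Fin 2)), p ∈ c.source := by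
  have hv : v ≠ 0 := by
    rintro rfl
    have := hmono 0 1 zero_le_one
    simp only [smul_zero, add_zero] at this
    linarith
  have hvv : inner ℝ v v ≠ (0 : ℝ) := inner_self_ne_zero.2 hv
  let lam : E3 →L[ℝ] ℝ := (inner ℝ v v : ℝ)⁻¹ • innerSL ℝ v
  have hlam : lam v = 1 := by
    change (inner ℝ v v : ℝ)⁻¹ * inner ℝ v v = 1
    exact inv_mul_cancel₀ hvv
  have hlam0 : lam ≠ 0 := fun h => by simp [h] at hlam
  let V := LinearMap.ker lam.toLinearMap
  have hrank : Module.finrank ℝ V = Module.finrank ℝ (EuclideanSpace ℝ (Fin 2)) := by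
    rw [finrank_ker hlam0, finrank_euclideanSpace_fin]
  let L : V ≃L[ℝ] EuclideanSpace ℝ (Fin 2) :=
    (LinearEquiv.ofFinrankEq V _ hrank).toContinuousLinearEquiv
  let proj : E3 → V := fun x => ⟨x - lam x • v, by
    change lam (x - lam x • v) = 0
    rw [map_sub, map_smul, hlam, smul_eq_mul, mul_one, sub_self]⟩
  have hproj : Continuous proj := Continuous.subtype_mk (by fun_prop) _
  -- `g` is strictly increasing along each line in direction `v`
  have hlt : ∀ x s t, s < t → g (x + s • v) < g (x + t • v) := fun x s t hst => by
    have h1 := hmono (x + s • v) (t - s) (by linarith)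
    have h2 : x + s • v + (t - s) • v = x + t • v := by module
    rw [h2] at h1
    have := mul_pos hδ (sub_pos.2 hst)
    linarith
  have hex : ∀ x : E3, ∃ t : ℝ, g (x + t • v) = 0 := by
    intro x
    have hc : Continuous fun t : ℝ => g (x + t • v) := by fun_prop
    have hr0 : 0 ≤ |g x| / δ := by positivity
    have hr : δ * (|g x| / δ) = |g x| := mul_div_cancel₀ _ hδ.ne'
    refine mem_range_of_exists_le_of_exists_ge hc ⟨-(|g x| / δ), ?_⟩ ⟨|g x| / δ, ?_⟩
    · have h1 := hmono (x + (-(|g x| / δ)) • v) (|g x| / δ) hr0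
      have h2 : x + (-(|g x| / δ)) • v + (|g x| / δ) • v = x := by module
      rw [h2, hr] at h1
      linarith [le_abs_self (g x)]
    · have h1 := hmono x (|g x| / δ) hr0
      rw [hr] at h1
      linarith [neg_abs_le (g x)]
  choose τ hτ using hex
  have hτlt : ∀ x a, τ x < a ↔ 0 < g (x + a • v) := fun x a => by
    rw [← hτ x]
    refine ⟨fun h => hlt x _ _ h, fun h => ?_⟩
    by_contra hle
    rcases (not_lt.1 hle).lt_or_eq with h2 | h2
    · exact absurd (hlt x _ _ h2) (not_lt.2 h.le)
    · rw [h2] at h; exact lt_irrefl _ h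
  have hτgt : ∀ x a, a < τ x ↔ g (x + a • v) < 0 := fun x a => by
    rw [← hτ x]
    refine ⟨fun h => hlt x _ _ h, fun h => ?_⟩
    by_contra hle
    rcases (not_lt.1 hle).lt_or_eq with h2 | h2
    · exact absurd (hlt x _ _ h2) (not_lt.2 h.le)
    · rw [← h2] at h; exact lt_irrefl _ h
  have hτc : Continuous τ := by
    rw [continuous_iff_lower_upperSemicontinuous, lowerSemicontinuous_iff_isOpen_preimage,
      upperSemicontinuous_iff_isOpen_preimage]
    refine ⟨fun a => ?_, fun a => ?_⟩
    · have : τ ⁻¹' Ioi a = {x | g (x + a • v) < 0} := Set.ext fun x => hτgt x a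
      rw [this]
      exact isOpen_lt (by fun_prop) continuous_const
    · have : τ ⁻¹' Iio a = {x | 0 < g (x + a • v)} := Set.ext fun x => hτlt x a
      rw [this]
      exact isOpen_lt continuous_const (by fun_prop)
  have hτuniq : ∀ x a, g (x + a • v) = 0 → τ x = a := fun x a h => by
    refine le_antisymm (not_lt.1 fun h1 => ?_) (not_lt.1 fun h1 => ?_)
    · rw [hτgt, h] at h1; exact lt_irrefl _ h1
    · rw [hτlt, h] at h1; exact lt_irrefl _ h1
  let σ : EuclideanSpace ℝ (Fin 2) → E3 := fun w => (L.symm w : E3) + τ (L.symm w) • v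
  have hLs : Continuous fun w => (L.symm w : E3) := continuous_subtype_val.comp L.symm.continuous
  have hσc : Continuous σ := hLs.add ((hτc.comp hLs).smul continuous_const)
  have hσg : ∀ w, g (σ w) = 0 := fun w => hτ _
  have hσproj : ∀ w, L (proj (σ w)) = w := by
    intro w
    have h0 : lam (L.symm w : E3) = 0 := (L.symm w).2
    have h1 : proj (σ w) = L.symm w := by
      apply Subtype.ext
      change σ w - lam (σ w) • v = _
      simp only [σ, map_add, map_smul, h0, hlam, smul_eq_mul, mul_one, zero_add,
        add_sub_cancel_right]
    rw [h1, L.apply_symm_apply]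
  have hprojσ : ∀ x, g x = 0 → σ (L (proj x)) = x := by
    intro x hx
    have h1 : (proj x : E3) + lam x • v = x := by
      change x - lam x • v + lam x • v = x
      abel
    have h2 : τ (proj x) = lam x := hτuniq _ _ (by rw [h1, hx])
    simp only [σ, L.symm_apply_apply, h2, h1]
  classical
  let c : OpenPartialHomeomorph S (EuclideanSpace ℝ (Fin 2)) :=
    { toFun := fun s => L (proj s)
      invFun := fun w => if h : σ w ∈ S then ⟨σ w, h⟩ else p
      source := {s | (s : E3) ∈ N}
      target := {w | σ w ∈ N}
      map_source' := fun s hs => by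
        change σ (L (proj s)) ∈ N
        rw [hprojσ s ((hSN s hs).1 s.2)]
        exact hs
      map_target' := fun w hw => by
        have hwS : σ w ∈ S := (hSN _ hw).2 (hσg w)
        change ((if h : σ w ∈ S then ⟨σ w, h⟩ else p : S) : E3) ∈ N
        rw [dif_pos hwS]
        exact hw
      left_inv' := fun s hs => by
        have e := hprojσ s ((hSN s hs).1 s.2)
        have hS : σ (L (proj s)) ∈ S := by rw [e]; exact s.2
        rw [dif_pos hS]
        exact Subtype.ext e
      right_inv' := fun w hw => by
        rw [dif_pos ((hSN _ hw).2 (hσg w))]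
        exact hσproj w
      open_source := hN.preimage continuous_subtype_val
      open_target := hN.preimage hσc
      continuousOn_toFun :=
        (L.continuous.comp (hproj.comp continuous_subtype_val)).continuousOn
      continuousOn_invFun := by
        rw [IsInducing.subtypeVal.continuousOn_iff]
        refine hσc.continuousOn.congr fun w hw => ?_
        change ((if h : σ w ∈ S then ⟨σ w, h⟩ else p : S) : E3) = σ w
        rw [dif_pos ((hSN _ hw).2 (hσg w))] }
  exact ⟨c, hp⟩

/-- If near `x` the set `P` is a superlevel set of a function growing along some direction, then
near `x` its boundary is the level set. -/
theorem mem_frontier_iff_of_superlevel {P N : Set E3} {g : E3 → ℝ} (hg : Continuous g) {v : E3}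
    {δ : ℝ} (hδ : 0 < δ) (hmono : ∀ x t, 0 ≤ t → g x + δ * t ≤ g (x + t • v)) (hN : IsOpen N)
    (hPN : ∀ x ∈ N, x ∈ P ↔ 0 ≤ g x) {x : E3} (hx : x ∈ N) : x ∈ frontier P ↔ g x = 0 := by
  rw [frontier_eq_closure_inter_closure]
  constructor
  · rintro ⟨h1, h2⟩
    refine le_antisymm (not_lt.1 fun h => ?_) (not_lt.1 fun h => ?_)
    · obtain ⟨y, ⟨hyN, hyg⟩, hyP⟩ := mem_closure_iff.1 h2 _
        (hN.inter (isOpen_lt continuous_const hg)) ⟨hx, h⟩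
      exact hyP ((hPN y hyN).2 (le_of_lt hyg))
    · obtain ⟨y, ⟨hyN, hyg⟩, hyP⟩ := mem_closure_iff.1 h1 _
        (hN.inter (isOpen_lt hg continuous_const)) ⟨hx, h⟩
      exact absurd ((hPN y hyN).1 hyP) (not_le.2 hyg)
  · intro h
    refine ⟨subset_closure ((hPN x hx).2 h.ge), mem_closure_iff.2 fun O hO hxO => ?_⟩
    obtain ⟨t, ht, ht0⟩ := ((eventually_mem_of_isOpen (hO.inter hN) ⟨hxO, hx⟩ (-v)).and
      self_mem_nhdsWithin).exists
    have ht0' : 0 < t := ht0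
    refine ⟨_, ht.1, fun hP => ?_⟩
    have h1 := (hPN _ ht.2).1 hP
    have h2 := hmono (x + t • (-v)) t ht0'.le
    have h3 : x + t • (-v) + t • v = x := by module
    rw [h3, h] at h2
    have := mul_pos hδ ht0'
    linarith

/-- The intersection of the half-spaces `b c ≤ φ c x`. -/
def halfspaces {κ : Type*} (φ : κ → E3 →L[ℝ] ℝ) (b : κ → ℝ) : Set E3 := {x | ∀ c, b c ≤ φ c x}

theorem isClosed_halfspaces {κ : Type*} (φ : κ → E3 →L[ℝ] ℝ) (b : κ → ℝ) :
    IsClosed (halfspaces φ b) := by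
  have : halfspaces φ b = ⋂ c, {x | b c ≤ φ c x} := by ext; simp [halfspaces]
  rw [this]
  exact isClosed_iInter fun c => isClosed_le continuous_const (φ c).continuous

theorem convex_halfspaces {κ : Type*} (φ : κ → E3 →L[ℝ] ℝ) (b : κ → ℝ) :
    Convex ℝ (halfspaces φ b) := by
  have : halfspaces φ b = ⋂ c, {x | b c ≤ φ c x} := by ext; simp [halfspaces]
  rw [this]
  exact convex_iInter fun c => convex_halfSpace_ge (φ c).toLinearMap.isLinear _

theorem exists_pos_le_of_pos {κ : Type*} [Finite κ] (f : κ → ℝ) :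
    ∃ δ > 0, ∀ c, 0 < f c → δ ≤ f c := by
  have : ∀ᶠ δ in 𝓝[>] (0 : ℝ), ∀ c, 0 < f c → δ ≤ f c :=
    eventually_all.2 fun c => by
      by_cases h : 0 < f c
      · filter_upwards [Ioc_mem_nhdsGT h] with δ hδ _
        exact hδ.2
      · exact Eventually.of_forall fun δ hc => absurd hc h
  obtain ⟨δ, h1, h2⟩ := (this.and self_mem_nhdsWithin).exists
  exact ⟨δ, h2, h1⟩

/-- A finite union of convex polyhedra has a surface as its boundary if at each boundary point some
direction points strictly inwards with respect to all constraints that are tight there. -/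
theorem nonempty_chartedSpace_frontier {I κ : Type*} [Finite I] [Finite κ] (φ : κ → E3 →L[ℝ] ℝ)
    (b : I → κ → ℝ) {P : Set E3} (hP : P = ⋃ i, halfspaces φ (b i))
    (h : ∀ p ∈ frontier P, ∃ v, ∀ i, p ∈ halfspaces φ (b i) → ∀ c, φ c p = b i c → 0 < φ c v) :
    Nonempty (ChartedSpace (EuclideanSpace ℝ (Fin 2)) (frontier P)) := by
  classical
  have := Fintype.ofFinite I
  have := Fintype.ofFinite κ
  have hcl : IsClosed P := by
    rw [hP]; exact isClosed_iUnion_of_finite fun i => isClosed_halfspaces φ (b i)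
  suffices H : ∀ p : frontier P,
      ∃ c : OpenPartialHomeomorph (frontier P) (EuclideanSpace ℝ (Fin 2)), p ∈ c.source by
    choose c hc using H
    exact ⟨{ atlas := range c, chartAt := c, mem_chart_source := hc,
             chart_mem_atlas := fun p => ⟨p, rfl⟩ }⟩
  rintro ⟨p, hp⟩
  obtain ⟨v, hv⟩ := h p hp
  obtain ⟨δ, hδ, hδv⟩ := exists_pos_le_of_pos fun c => φ c v
  let J : Finset I := Finset.univ.filter fun i => p ∈ halfspaces φ (b i)
  let A : I → Finset κ := fun i => Finset.univ.filter fun c => φ c p = b i c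
  have hJ : ∀ i, i ∈ J ↔ p ∈ halfspaces φ (b i) := fun i => by simp [J]
  have hA : ∀ i c, c ∈ A i ↔ φ c p = b i c := fun i c => by simp [A]
  have hJne : J.Nonempty := by
    have := hcl.frontier_subset hp
    rw [hP, mem_iUnion] at this
    obtain ⟨i, hi⟩ := this
    exact ⟨i, (hJ i).2 hi⟩
  let N : Set E3 := {x | (∀ i, i ∉ J → x ∉ halfspaces φ (b i)) ∧
    ∀ i ∈ J, ∀ c, c ∉ A i → b i c < φ c x}
  have hNo : IsOpen N := by
    refine IsOpen.inter (s := {x | ∀ i, i ∉ J → x ∉ halfspaces φ (b i)})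
      (t := {x | ∀ i ∈ J, ∀ c, c ∉ A i → b i c < φ c x}) ?_ ?_
    · simp only [ofPred_forall]
      exact isOpen_iInter_of_finite fun i => isOpen_iInter_of_finite fun _ =>
        (isClosed_halfspaces φ (b i)).isOpen_compl
    · simp only [ofPred_forall]
      exact isOpen_iInter_of_finite fun i => isOpen_iInter_of_finite fun _ =>
        isOpen_iInter_of_finite fun c => isOpen_iInter_of_finite fun _ =>
          isOpen_lt continuous_const (φ c).continuous
  have hpN : p ∈ N := ⟨fun i hi => fun h => hi ((hJ i).2 h), fun i hi c hc =>
    lt_of_le_of_ne ((hJ i).1 hi c) fun h => hc ((hA i c).2 h.symm)⟩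
  have hAne : ∀ i ∈ J, (A i).Nonempty := by
    intro i hi
    by_contra hne
    rw [Finset.not_nonempty_iff_eq_empty] at hne
    rw [hcl.frontier_eq] at hp
    refine hp.2 (mem_interior_iff_mem_nhds.2 (mem_of_superset (hNo.mem_nhds hpN) fun x hx => ?_))
    rw [hP, mem_iUnion]
    exact ⟨i, fun c => (hx.2 i hi c (by simp [hne])).le⟩
  -- the local equation of `P`: the largest over the pieces of the least tight constraint
  let m : I → E3 → ℝ := fun i x =>
    if hi : i ∈ J then (A i).inf' (hAne i hi) fun c => φ c x - b i c else 0
  have hm : ∀ i (hi : i ∈ J), m i = fun x => (A i).inf' (hAne i hi) fun c => φ c x - b i c :=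
    fun i hi => funext fun x => dif_pos hi
  let g : E3 → ℝ := fun x => J.sup' hJne fun i => m i x
  have hmc : ∀ i ∈ J, Continuous (m i) := fun i hi => by
    rw [hm i hi]
    exact Continuous.finset_inf'_apply _ fun c _ => by fun_prop
  have hgc : Continuous g := Continuous.finset_sup'_apply _ hmc
  have hmono : ∀ x t, 0 ≤ t → g x + δ * t ≤ g (x + t • v) := by
    intro x t ht
    rw [← le_sub_iff_add_le]
    refine Finset.sup'_le _ _ fun i hi => ?_
    rw [le_sub_iff_add_le]
    refine le_trans ?_ (Finset.le_sup' (fun i => m i (x + t • v)) hi)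
    simp only [hm i hi]
    refine Finset.le_inf' _ _ fun c hc => ?_
    have h1 := Finset.inf'_le (fun c => φ c x - b i c) hc
    have h2 := hδv c (hv i ((hJ i).1 hi) c ((hA i c).1 hc))
    rw [map_add, map_smul, smul_eq_mul]
    nlinarith
  have hPN : ∀ x ∈ N, x ∈ P ↔ 0 ≤ g x := by
    intro x hx
    rw [hP, mem_iUnion, Finset.le_sup'_iff]
    constructor
    · rintro ⟨i, hi⟩
      have hiJ : i ∈ J := by
        by_contra hn
        exact hx.1 i hn hi
      refine ⟨i, hiJ, ?_⟩
      rw [hm i hiJ]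
      exact Finset.le_inf' _ _ fun c _ => sub_nonneg.2 (hi c)
    · rintro ⟨i, hi, h0⟩
      rw [hm i hi] at h0
      rw [Finset.le_inf'_iff] at h0
      refine ⟨i, fun c => ?_⟩
      by_cases hc : c ∈ A i
      · exact sub_nonneg.1 (h0 c hc)
      · exact (hx.2 i hi c hc).le
  exact exists_chart hgc hδ hmono hNo
    (fun x hx => mem_frontier_iff_of_superlevel hgc hδ hmono hNo hPN hx) ⟨p, hp⟩ hpN

/-! ### Convex polyhedra as unions of tetrahedra -/

theorem finite_extremePoints_halfspaces {κ : Type*} [Finite κ] (φ : κ → E3 →L[ℝ] ℝ) (b : κ → ℝ) :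
    ((halfspaces φ b).extremePoints ℝ).Finite := by
  -- an extreme point is determined by its set of tight constraints
  refine Set.Finite.of_finite_image (f := fun x => {c | φ c x = b c}) (Set.toFinite _) ?_
  intro x hx y hy hxy
  by_contra hne
  have hact : ∀ c, φ c x = b c → φ c (y - x) = 0 := fun c hc => by
    have : φ c y = b c := (Set.ext_iff.1 hxy c).1 hc
    rw [map_sub, this, hc, sub_self]
  have hmem : ∀ w, (∀ c, φ c x = b c → φ c w = 0) →
      ∀ᶠ t in 𝓝[>] (0 : ℝ), x + t • w ∈ halfspaces φ b := by
    intro w hw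
    refine eventually_all.2 fun c => ?_
    by_cases hc : φ c x = b c
    · refine Eventually.of_forall fun t => ?_
      rw [map_add, map_smul, hw c hc, smul_zero, add_zero, hc]
    · have hlt : b c < φ c x := lt_of_le_of_ne (hx.1 c) (Ne.symm hc)
      filter_upwards [eventually_mem_of_isOpen (isOpen_lt continuous_const (φ c).continuous)
        hlt w] with t ht
      exact le_of_lt ht
  obtain ⟨t, ⟨h1, h2⟩, ht⟩ := (((hmem (y - x) hact).and (hmem (-(y - x)) fun c hc => by
    rw [map_neg, hact c hc, neg_zero])).and self_mem_nhdsWithin).exists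
  have ht0 : (0 : ℝ) < t := ht
  have hseg : x ∈ openSegment ℝ (x + t • (y - x)) (x + t • -(y - x)) :=
    ⟨1 / 2, 1 / 2, by norm_num, by norm_num, by norm_num, by module⟩
  have h3 := ((mem_extremePoints.1 hx).2 _ h1 _ h2 hseg).1
  rw [add_eq_left, smul_eq_zero, sub_eq_zero] at h3
  exact h3.elim ht0.ne' fun h => hne h.symm

/-- In a finite spanning set, affinely independent subsets extend to affine bases. -/
theorem exists_affineIndependent_extension {s t : Set E3} (hs : s.Finite)
    (hspan : affineSpan ℝ s = ⊤) (hts : t ⊆ s) (ht : AffineIndependent ℝ ((↑) : t → E3)) :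
    ∃ u, t ⊆ u ∧ u ⊆ s ∧ AffineIndependent ℝ ((↑) : u → E3) ∧ affineSpan ℝ u = ⊤ := by
  have hfin : {u : Set E3 | u ⊆ s ∧ AffineIndependent ℝ ((↑) : u → E3)}.Finite :=
    hs.finite_subsets.subset fun u hu => hu.1
  obtain ⟨u, htu, hu⟩ := hfin.exists_le_maximal (show t ∈ _ from ⟨hts, ht⟩)
  refine ⟨u, htu, hu.1.1, hu.1.2, ?_⟩
  by_contra htop
  obtain ⟨p, hp, hpu⟩ : ∃ p ∈ s, p ∉ affineSpan ℝ u := by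
    by_contra hcon
    push Not at hcon
    have : affineSpan ℝ s ≤ affineSpan ℝ u := affineSpan_le.2 hcon
    rw [hspan] at this
    exact htop (top_le_iff.1 this)
  have hpu' : p ∉ u := fun h => hpu (subset_affineSpan ℝ u h)
  have hins : AffineIndependent ℝ ((↑) : ↥(insert p u : Set E3) → E3) := by
    let i : (insert p u : Set E3) := ⟨p, mem_insert p u⟩
    refine AffineIndependent.affineIndependent_of_notMem_span (i := i) ?_ ?_
    · let emb : {y : (insert p u : Set E3) // y ≠ i} ↪ u :=
        ⟨fun y => ⟨y.1.1, y.1.2.resolve_left fun h => y.2 (Subtype.ext h)⟩, fun y z h => by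
          have := congrArg Subtype.val h
          exact Subtype.ext (Subtype.ext this)⟩
      exact hu.1.2.comp_embedding emb
    · refine fun hmem => hpu (affineSpan_mono ℝ ?_ hmem)
      rintro _ ⟨y, hy, rfl⟩
      exact y.2.resolve_left fun h => hy (Subtype.ext h)
  exact hpu' (hu.2 ⟨insert_subset hp hu.1.1, hins⟩ (subset_insert p u) (mem_insert p u))

theorem isTetrahedron_convexHull {u : Set E3} (hu : AffineIndependent ℝ ((↑) : u → E3))
    (htop : affineSpan ℝ u = ⊤) (hfin : u.Finite) : IsTetrahedron (convexHull ℝ u) := by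
  have := hfin.fintype
  have hcard : Fintype.card u = 4 := by
    have h := hu.affineSpan_eq_top_iff_card_eq_finrank_add_one
    rw [Subtype.range_coe, finrank_euclideanSpace_fin] at h
    exact h.1 htop
  let e : Fin 4 ≃ u := (Fintype.equivFinOfCardEq hcard).symm
  refine ⟨fun i => (e i : E3), hu.comp_embedding e.toEmbedding, ?_⟩
  congr 1
  ext x
  constructor
  · intro hx
    exact ⟨e.symm ⟨x, hx⟩, by simp⟩
  · rintro ⟨i, rfl⟩
    exact (e i).2

/-- A bounded intersection of finitely many half-spaces with an interior point is a finite union of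
tetrahedra: by Krein–Milman it is the convex hull of its finitely many extreme points, and
by Carathéodory each of its points lies in a simplex on some of them. -/
theorem exists_tetrahedra_of_halfspaces {κ : Type*} [Finite κ] {φ : κ → E3 →L[ℝ] ℝ} {b : κ → ℝ}
    (hb : Bornology.IsBounded (halfspaces φ b)) (hi : (interior (halfspaces φ b)).Nonempty) :
    ∃ 𝒯 : Set (Set E3), 𝒯.Finite ∧ (∀ T ∈ 𝒯, IsTetrahedron T) ∧ halfspaces φ b = ⋃₀ 𝒯 := by
  have hcpt : IsCompact (halfspaces φ b) :=
    Metric.isCompact_of_isClosed_isBounded (isClosed_halfspaces φ b) hb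
  set s := (halfspaces φ b).extremePoints ℝ with hs
  have hsfin : s.Finite := finite_extremePoints_halfspaces φ b
  have hK : convexHull ℝ s = halfspaces φ b := by
    rw [← closure_convexHull_extremePoints hcpt (convex_halfspaces φ b),
      (hsfin.isClosed_convexHull ℝ).closure_eq]
  have hspan : affineSpan ℝ s = ⊤ := by
    rw [← interior_convexHull_nonempty_iff_affineSpan_eq_top, hK]
    exact hi
  refine ⟨convexHull ℝ '' {u | u ⊆ s ∧ AffineIndependent ℝ ((↑) : u → E3) ∧ affineSpan ℝ u = ⊤},
    (hsfin.finite_subsets.subset fun u hu => hu.1).image _, ?_, ?_⟩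
  · rintro _ ⟨u, ⟨hus, hu, htop⟩, rfl⟩
    exact isTetrahedron_convexHull hu htop (hsfin.subset hus)
  · rw [← hK]
    refine Subset.antisymm (fun x hx => ?_) ?_
    · rw [convexHull_eq_union] at hx
      simp only [mem_iUnion, exists_prop] at hx
      obtain ⟨t, hts, ht, hxt⟩ := hx
      obtain ⟨u, htu, hus, hu, htop⟩ := exists_affineIndependent_extension hsfin hspan hts ht
      exact ⟨_, ⟨u, ⟨hus, hu, htop⟩, rfl⟩, convexHull_mono htu hxt⟩
    · rintro x ⟨_, ⟨u, ⟨hus, -, -⟩, rfl⟩, hx⟩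
      exact convexHull_mono hus hx

/-! ### A chain of corner simplices -/

/-- The sum of the coordinates. -/
noncomputable def csum : E3 →L[ℝ] ℝ := EuclideanSpace.proj 0 + EuclideanSpace.proj 1 + EuclideanSpace.proj 2

theorem csum_apply (x : E3) : csum x = x 0 + x 1 + x 2 := rfl

/-- The point with coordinate `c` in position `a` and `d` in the other two positions. -/
def pt (c d : ℝ) (a : Fin 3) : E3 := WithLp.toLp 2 fun b => if b = a then c else d

@[simp] theorem pt_same (c d : ℝ) (a : Fin 3) : pt c d a a = c := if_pos rfl

theorem pt_ne (c d : ℝ) {a b : Fin 3} (h : b ≠ a) : pt c d a b = d := if_neg h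

@[simp] theorem csum_pt (c d : ℝ) (a : Fin 3) : csum (pt c d a) = c + 2 * d := by
  fin_cases a <;> simp [csum_apply, pt] <;> ring

theorem coord_add_smul (x w : E3) (t : ℝ) (a : Fin 3) : (x + t • w) a = x a + t * w a := rfl

theorem csum_add_smul (x w : E3) (t : ℝ) : csum (x + t • w) = csum x + t * csum w := by
  rw [map_add, map_smul, smul_eq_mul]

theorem csum_eq_of_ne (x : E3) {a b c : Fin 3} (hab : a ≠ b) (hac : a ≠ c) (hbc : b ≠ c) :
    csum x = x a + x b + x c := by
  rw [csum_apply]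
  fin_cases a <;> fin_cases b <;> fin_cases c <;> simp at hab hac hbc ⊢ <;> ring

theorem exists_others (a : Fin 3) : ∃ b c : Fin 3, a ≠ b ∧ a ≠ c ∧ b ≠ c := by
  revert a; decide

theorem eq_or_eq_of_ne {a b c d : Fin 3} (hab : a ≠ b) (hac : a ≠ c) (hbc : b ≠ c) (hda : d ≠ a) :
    d = b ∨ d = c := by
  revert a b c d; decide

theorem eventually_coord_lt {x : E3} {a : Fin 3} {c : ℝ} (h : x a < c) : ∀ᶠ y in 𝓝 x, y a < c :=
  (EuclideanSpace.proj (𝕜 := ℝ) a).continuous.continuousAt.eventually_lt_const h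

theorem eventually_lt_coord {x : E3} {a : Fin 3} {c : ℝ} (h : c < x a) : ∀ᶠ y in 𝓝 x, c < y a :=
  (EuclideanSpace.proj (𝕜 := ℝ) a).continuous.continuousAt.eventually_const_lt h

theorem eventually_csum_lt {x : E3} {c : ℝ} (h : csum x < c) : ∀ᶠ y in 𝓝 x, csum y < c :=
  csum.continuous.continuousAt.eventually_lt_const h

theorem eventually_lt_csum {x : E3} {c : ℝ} (h : c < csum x) : ∀ᶠ y in 𝓝 x, c < csum y :=
  csum.continuous.continuousAt.eventually_const_lt h

/-- The upper bound for coordinate `a` in the `i`-th piece. It cuts off a corner of the first piece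
for `a ∈ R` and is redundant otherwise. -/
noncomputable def cap (R : Finset (Fin 3)) (i : ℕ) (a : Fin 3) : ℝ :=
  if i = 0 ∧ a ∈ R then 11 / 2 else 2 * i + 8

theorem le_cap (R : Finset (Fin 3)) (i : ℕ) (a : Fin 3) : 2 * (i : ℝ) + 11 / 2 ≤ cap R i a := by
  unfold cap
  split_ifs with h
  · simp [h.1]
  · linarith

theorem cap_of_mem {R : Finset (Fin 3)} {a : Fin 3} (h : a ∈ R) : cap R 0 a = 11 / 2 :=
  if_pos ⟨rfl, h⟩

theorem cap_of_not {R : Finset (Fin 3)} {i : ℕ} {a : Fin 3} (h : ¬ (i = 0 ∧ a ∈ R)) :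
    cap R i a = 2 * i + 8 := if_neg h

/-- The normals of the half-spaces bounding each piece. -/
noncomputable def pieceNormal : Fin 3 ⊕ (Fin 3 ⊕ Unit) → E3 →L[ℝ] ℝ
  | .inl a => EuclideanSpace.proj a
  | .inr (.inl a) => -EuclideanSpace.proj a
  | .inr (.inr _) => -csum

/-- The offsets of the half-spaces bounding the `i`-th piece. -/
noncomputable def pieceOffset (R : Finset (Fin 3)) (i : ℕ) : Fin 3 ⊕ (Fin 3 ⊕ Unit) → ℝ
  | .inl _ => 2 * i
  | .inr (.inl a) => -cap R i a
  | .inr (.inr _) => -(6 * i + 7)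

/-- The `i`-th piece: the corner simplex `x a ≥ 2 i`, `∑ x a ≤ 6 i + 7`, with some corners cut off
if `i = 0`. The vertex `(2 i, 2 i, 2 i)` pierces the opposite face of the preceding piece. -/
noncomputable def piece (R : Finset (Fin 3)) (i : ℕ) : Set E3 :=
  halfspaces pieceNormal (pieceOffset R i)

theorem mem_piece {R : Finset (Fin 3)} {i : ℕ} {x : E3} :
    x ∈ piece R i ↔
      (∀ a, 2 * (i : ℝ) ≤ x a) ∧ (∀ a, x a ≤ cap R i a) ∧ csum x ≤ 6 * (i : ℝ) + 7 := by
  constructor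
  · intro h
    refine ⟨fun a => h (.inl a), fun a => ?_, ?_⟩
    · have : -cap R i a ≤ -(x a) := h (.inr (.inl a))
      linarith
    · have : -(6 * (i : ℝ) + 7) ≤ -(csum x) := h (.inr (.inr ()))
      linarith
  · rintro ⟨h1, h2, h3⟩ (a | a | _)
    · exact h1 a
    · exact neg_le_neg (h2 a)
    · exact neg_le_neg h3

/-- The union of the first `k` pieces. -/
noncomputable def chain (k : ℕ) (R : Finset (Fin 3)) : Set E3 := ⋃ i : Fin k, piece R i

theorem mem_chain {k : ℕ} {R : Finset (Fin 3)} {x : E3} :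
    x ∈ chain k R ↔ ∃ i < k, x ∈ piece R i := by
  rw [chain, mem_iUnion]
  exact ⟨fun ⟨i, h⟩ => ⟨i, i.2, h⟩, fun ⟨i, hi, h⟩ => ⟨⟨i, hi⟩, h⟩⟩

theorem isClosed_chain (k : ℕ) (R : Finset (Fin 3)) : IsClosed (chain k R) :=
  isClosed_iUnion_of_finite fun _ => isClosed_halfspaces _ _

theorem mem_interior_piece {R : Finset (Fin 3)} {i : ℕ} {x : E3} (h1 : ∀ a, 2 * (i : ℝ) < x a)
    (h2 : ∀ a, x a < cap R i a) (h3 : csum x < 6 * (i : ℝ) + 7) : x ∈ interior (piece R i) := by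
  rw [mem_interior_iff_mem_nhds]
  filter_upwards [eventually_all.2 fun a => eventually_lt_coord (h1 a),
    eventually_all.2 fun a => eventually_coord_lt (h2 a), eventually_csum_lt h3] with y hy1 hy2 hy3
  exact mem_piece.2 ⟨fun a => (hy1 a).le, fun a => (hy2 a).le, hy3.le⟩

theorem interior_piece_subset {k : ℕ} {R : Finset (Fin 3)} {i : ℕ} (hi : i < k) :
    interior (piece R i) ⊆ interior (chain k R) :=
  interior_mono fun _ hx => mem_chain.2 ⟨i, hi, hx⟩

theorem pt_mem_interior_piece (R : Finset (Fin 3)) (i : ℕ) :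
    pt (2 * i + 1) (2 * i + 1) 0 ∈ interior (piece R i) := by
  have h : ∀ a, pt (2 * (i : ℝ) + 1) (2 * i + 1) 0 a = 2 * i + 1 := fun a => by simp [pt]
  refine mem_interior_piece (fun a => ?_) (fun a => ?_) ?_
  · rw [h]; linarith
  · rw [h]; linarith [le_cap R i a]
  · rw [csum_pt]; linarith

theorem isBounded_piece (R : Finset (Fin 3)) (i : ℕ) : Bornology.IsBounded (piece R i) := by
  refine (Metric.isBounded_iff_subset_closedBall 0).2 ⟨Real.sqrt (3 * (6 * i + 7) ^ 2), ?_⟩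
  intro x hx
  obtain ⟨h1, -, h3⟩ := mem_piece.1 hx
  rw [mem_closedBall_zero_iff, EuclideanSpace.norm_eq]
  refine Real.sqrt_le_sqrt ?_
  have hi : (0 : ℝ) ≤ i := Nat.cast_nonneg i
  rw [csum_apply] at h3
  have b0 := h1 0
  have b1 := h1 1
  have b2 := h1 2
  have hb : ∀ a, x a ^ 2 ≤ (6 * (i : ℝ) + 7) ^ 2 := by
    intro a
    have ha := h1 a
    have : x a ≤ 6 * (i : ℝ) + 7 := by fin_cases a <;> simp <;> linarith
    exact pow_le_pow_left₀ (by linarith) this 2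
  rw [Fin.sum_univ_three]
  simp only [Real.norm_eq_abs, sq_abs]
  linarith [hb 0, hb 1, hb 2]

/-- Only consecutive pieces meet. -/
theorem le_succ_of_mem_piece {R : Finset (Fin 3)} {i j : ℕ} {x : E3} (hi : x ∈ piece R i)
    (hj : x ∈ piece R j) : j ≤ i + 1 := by
  obtain ⟨-, -, h3⟩ := mem_piece.1 hi
  obtain ⟨h1, -, -⟩ := mem_piece.1 hj
  rw [csum_apply] at h3
  have b0 := h1 0
  have b1 := h1 1
  have b2 := h1 2
  by_contra h
  have : (i : ℝ) + 2 ≤ j := by exact_mod_cast (by omega : i + 2 ≤ j)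
  linarith

theorem isConnected_chain {k : ℕ} (hk : 0 < k) (R : Finset (Fin 3)) : IsConnected (chain k R) := by
  induction k with
  | zero => exact absurd hk (lt_irrefl 0)
  | succ n ih =>
    have hpc : IsConnected (piece R n) :=
      ⟨⟨_, interior_subset (pt_mem_interior_piece R n)⟩, (convex_halfspaces _ _).isPreconnected⟩
    have hunion : chain (n + 1) R = chain n R ∪ piece R n := by
      ext x
      rw [mem_union, mem_chain, mem_chain]
      constructor
      · rintro ⟨i, hi, hx⟩
        rcases Nat.lt_succ_iff_lt_or_eq.1 hi with h | rfl
        · exact Or.inl ⟨i, h, hx⟩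
        · exact Or.inr hx
      · rintro (⟨i, hi, hx⟩ | hx)
        · exact ⟨i, by omega, hx⟩
        · exact ⟨n, by omega, hx⟩
    rcases n with _ | m
    · have : chain 0 R = ∅ := by ext x; simp [mem_chain]
      rw [hunion, this, empty_union]
      exact hpc
    · rw [hunion]
      have h : ∀ a, pt (2 * ((m : ℝ) + 1)) (2 * ((m : ℝ) + 1)) 0 a = 2 * ((m : ℝ) + 1) :=
        fun a => by simp [pt]
      refine IsConnected.union ⟨pt (2 * ((m : ℝ) + 1)) (2 * ((m : ℝ) + 1)) 0,
        mem_chain.2 ⟨m, by omega, mem_piece.2 ⟨fun a => ?_, fun a => ?_, ?_⟩⟩,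
        mem_piece.2 ⟨fun a => ?_, fun a => ?_, ?_⟩⟩ (ih (by omega)) hpc
      · rw [h]; linarith
      · rw [h]; linarith [le_cap R m a]
      · rw [csum_pt]; linarith
      · rw [h]; push_cast; linarith
      · rw [h]; have := le_cap R (m + 1) a; push_cast at this; linarith
      · rw [csum_pt]; push_cast; linarith

/-- At a boundary point, a direction pointing strictly inwards: towards the centre of the only piece
that contains the point, or else decreasing the sum of the coordinates and increasing those that
are minimal in the second piece. -/
theorem exists_inward_direction {k : ℕ} (R : Finset (Fin 3)) {p : E3} (hp : p ∈ chain k R) :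
    ∃ v, ∀ i : Fin k, p ∈ piece R i → ∀ c, pieceNormal c p = pieceOffset R i c →
      0 < pieceNormal c v := by
  classical
  have hex := mem_chain.1 hp
  set i := Nat.find hex with hi
  obtain ⟨hik, hpi⟩ := Nat.find_spec hex
  rw [← hi] at hik hpi
  have hmin : ∀ j : Fin k, p ∈ piece R j → i ≤ j := fun j hj => Nat.find_min' hex ⟨j.2, hj⟩
  have hmax : ∀ j : Fin k, p ∈ piece R j → (j : ℕ) ≤ i + 1 := fun j hj =>
    le_succ_of_mem_piece hpi hj
  by_cases hsucc : p ∈ piece R (i + 1)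
  · obtain ⟨l1, l2, l3⟩ := mem_piece.1 hsucc
    obtain ⟨m1, m2, m3⟩ := mem_piece.1 hpi
    push_cast at l1 l2 l3
    have hle : ∀ a, p a ≤ 2 * i + 3 := by
      intro a
      rw [csum_apply] at m3
      have b0 := l1 0
      have b1 := l1 1
      have b2 := l1 2
      fin_cases a <;> simp <;> linarith
    -- constraints other than those dealt with by `v` are not tight
    have key : ∀ v : E3, (∀ a, p a = 2 * (i + 1 : ℝ) → 0 < v a) →
        (csum p = 6 * (i : ℝ) + 7 → csum v < 0) → ∀ j : Fin k, p ∈ piece R j →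
        ∀ c, pieceNormal c p = pieceOffset R j c → 0 < pieceNormal c v := by
      intro v hv1 hv2 j hj c hc
      have hji : (j : ℕ) = i ∨ (j : ℕ) = i + 1 := by have := hmin j hj; have := hmax j hj; omega
      rcases c with a | a | _
      · have hc' : p a = 2 * ((j : ℕ) : ℝ) := hc
        refine hv1 a ?_
        rcases hji with h | h
        · rw [h] at hc'; linarith [l1 a]
        · rw [h] at hc'; push_cast at hc'; exact hc'
      · have hc' : -(p a) = -cap R j a := hc
        have h1 := le_cap R j a
        have h2 : (i : ℝ) ≤ (j : ℕ) := by exact_mod_cast hmin j hj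
        linarith [hle a]
      · have hc' : -(csum p) = -(6 * ((j : ℕ) : ℝ) + 7) := hc
        have h2 : (i : ℝ) ≤ (j : ℕ) := by exact_mod_cast hmin j hj
        have : 0 < -(csum v) := neg_pos.2 (hv2 (by linarith))
        exact this
    by_cases hs : csum p = 6 * (i : ℝ) + 7
    · obtain ⟨a, ha⟩ : ∃ a, p a ≠ 2 * (i + 1 : ℝ) := by
        by_contra hcon
        push Not at hcon
        rw [csum_apply, hcon, hcon, hcon] at hs
        linarith
      refine ⟨pt (-3) 1 a, key _ (fun b hb => ?_) fun _ => by rw [csum_pt]; norm_num⟩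
      have hba : b ≠ a := by rintro rfl; exact ha hb
      rw [pt_ne _ _ hba]; exact one_pos
    · exact ⟨pt 1 1 0, key _ (fun b _ => by simp [pt]) fun h => absurd h hs⟩
  · refine ⟨pt (2 * i + 1) (2 * i + 1) 0 - p, fun j hj c hc => ?_⟩
    have hji : (j : ℕ) = i := by
      have h1 := hmin j hj
      have h2 := hmax j hj
      have h3 : (j : ℕ) ≠ i + 1 := fun h => hsucc (h ▸ hj)
      omega
    rw [hji] at hc
    rw [map_sub, hc]
    have h : ∀ a, pt (2 * (i : ℝ) + 1) (2 * i + 1) 0 a = 2 * i + 1 := fun a => by simp [pt]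
    rcases c with a | a | _
    · change 0 < pt (2 * (i : ℝ) + 1) (2 * i + 1) 0 a - 2 * i
      rw [h]; linarith
    · change 0 < -(pt (2 * (i : ℝ) + 1) (2 * i + 1) 0 a) - -cap R i a
      rw [h]; linarith [le_cap R i a]
    · change 0 < -(csum (pt (2 * (i : ℝ) + 1) (2 * i + 1) 0)) - -(6 * (i : ℝ) + 7)
      rw [csum_pt]; linarith

theorem isPolyhedron_chain {k : ℕ} (hk : 0 < k) (R : Finset (Fin 3)) : IsPolyhedron (chain k R) := by
  refine ⟨isConnected_chain hk R, ?_, ?_⟩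
  · choose 𝒯 hfin hT hU using fun i : Fin k => exists_tetrahedra_of_halfspaces
      (isBounded_piece R i) ⟨_, pt_mem_interior_piece R i⟩
    refine ⟨⋃ i, 𝒯 i, Set.finite_iUnion hfin, fun T hTm => ?_, ?_⟩
    · obtain ⟨i, hi⟩ := mem_iUnion.1 hTm
      exact hT i T hi
    · rw [sUnion_iUnion]
      exact iUnion_congr hU
  · exact nonempty_chartedSpace_frontier pieceNormal (fun i : Fin k => pieceOffset R i) rfl
      fun p hp => exists_inward_direction R ((isClosed_chain k R).frontier_subset hp)

/-! ### The faces of the chain -/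

/-- Labels for the faces of the chain: the coordinate faces of the pieces, their outer faces, and
the cuts at the corners of the first piece. -/
abbrev FaceLabel (k : ℕ) (R : Finset (Fin 3)) : Type := (Fin k × Fin 3) ⊕ (Fin k ⊕ R)

/-- The normal of the plane of a face. -/
noncomputable def faceNormal {k : ℕ} {R : Finset (Fin 3)} : FaceLabel k R → E3 →L[ℝ] ℝ
  | .inl p => EuclideanSpace.proj p.2
  | .inr (.inl _) => csum
  | .inr (.inr a) => EuclideanSpace.proj (a : Fin 3)

/-- The offset of the plane of a face. -/
noncomputable def faceOffset {k : ℕ} {R : Finset (Fin 3)} : FaceLabel k R → ℝ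
  | .inl p => 2 * (p.1 : ℕ)
  | .inr (.inl i) => 6 * (i : ℕ) + 7
  | .inr (.inr _) => 11 / 2

/-- The faces of the chain. A coordinate face loses the tip that lies in the preceding piece, and an
outer face has a triangular hole through which the next piece emerges. -/
def closedCell {k : ℕ} {R : Finset (Fin 3)} : FaceLabel k R → Set E3
  | .inl (i, a) => {x | x a = 2 * (i : ℕ) ∧ (∀ b, b ≠ a → 2 * ((i : ℕ) : ℝ) ≤ x b) ∧
      (∀ b, x b ≤ cap R i b) ∧ csum x ≤ 6 * (i : ℕ) + 7 ∧
      (0 < (i : ℕ) → 6 * ((i : ℕ) : ℝ) + 1 ≤ csum x)}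
  | .inr (.inl i) => {x | csum x = 6 * (i : ℕ) + 7 ∧ (∀ b, 2 * ((i : ℕ) : ℝ) ≤ x b) ∧
      (∀ b, x b ≤ cap R i b) ∧ ((i : ℕ) + 1 < k → ∃ b : Fin 3, x b ≤ 2 * ((i : ℕ) : ℝ) + 2)}
  | .inr (.inr a) => {x | x a = 11 / 2 ∧ (∀ b, b ≠ (a : Fin 3) → 0 ≤ x b) ∧ csum x ≤ 7}

/-- The faces of the chain with all inequalities strict. -/
def openCell {k : ℕ} {R : Finset (Fin 3)} : FaceLabel k R → Set E3
  | .inl (i, a) => {x | x a = 2 * (i : ℕ) ∧ (∀ b, b ≠ a → 2 * ((i : ℕ) : ℝ) < x b) ∧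
      (∀ b, x b < cap R i b) ∧ csum x < 6 * (i : ℕ) + 7 ∧
      (0 < (i : ℕ) → 6 * ((i : ℕ) : ℝ) + 1 < csum x)}
  | .inr (.inl i) => {x | csum x = 6 * (i : ℕ) + 7 ∧ (∀ b, 2 * ((i : ℕ) : ℝ) < x b) ∧
      (∀ b, x b < cap R i b) ∧ ((i : ℕ) + 1 < k → ∃ b : Fin 3, x b < 2 * ((i : ℕ) : ℝ) + 2)}
  | .inr (.inr a) => {x | x a = 11 / 2 ∧ (∀ b, b ≠ (a : Fin 3) → 0 < x b) ∧ csum x < 7}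

variable {k : ℕ} {R : Finset (Fin 3)}

theorem closedCell_subset_plane (c : FaceLabel k R) :
    closedCell c ⊆ plane (faceNormal c) (faceOffset c) := by
  rcases c with ⟨i, a⟩ | i | a <;> exact fun x hx => hx.1

theorem openCell_subset_closedCell (c : FaceLabel k R) : openCell c ⊆ closedCell c := by
  rcases c with ⟨i, a⟩ | i | a
  · rintro x ⟨h1, h2, h3, h4, h5⟩
    exact ⟨h1, fun b hb => (h2 b hb).le, fun b => (h3 b).le, h4.le, fun h => (h5 h).le⟩
  · rintro x ⟨h1, h2, h3, h4⟩
    exact ⟨h1, fun b => (h2 b).le, fun b => (h3 b).le, fun h => (h4 h).imp fun b hb => hb.le⟩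
  · rintro x ⟨h1, h2, h3⟩
    exact ⟨h1, fun b hb => (h2 b hb).le, h3.le⟩

theorem faceNormal_ne_zero (c : FaceLabel k R) : faceNormal c ≠ 0 := by
  intro h
  have key : faceNormal c (pt 1 1 0) = 0 := by rw [h]; rfl
  have h1 : ∀ a, pt 1 1 0 a = 1 := fun a => by simp [pt]
  rcases c with ⟨i, a⟩ | i | a
  · have : pt 1 1 0 a = 0 := key
    rw [h1] at this; norm_num at this
  · have : csum (pt 1 1 0) = 0 := key
    rw [csum_pt] at this; norm_num at this
  · have : pt 1 1 0 (a : Fin 3) = 0 := key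
    rw [h1] at this; norm_num at this

theorem closedCell_subset_chain (c : FaceLabel k R) (hk : 0 < k) : closedCell c ⊆ chain k R := by
  rcases c with ⟨i, a⟩ | i | a
  · rintro x ⟨h1, h2, h3, h4, -⟩
    refine mem_chain.2 ⟨i, i.2, mem_piece.2 ⟨fun b => ?_, h3, h4⟩⟩
    by_cases hb : b = a
    · rw [hb, h1]
    · exact h2 b hb
  · rintro x ⟨h1, h2, h3, -⟩
    exact mem_chain.2 ⟨i, i.2, mem_piece.2 ⟨h2, h3, h1.le⟩⟩
  · rintro x ⟨h1, h2, h3⟩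
    refine mem_chain.2 ⟨0, hk, mem_piece.2 ⟨fun b => ?_, fun b => ?_, ?_⟩⟩
    · by_cases hb : b = a
      · rw [hb, h1]; norm_num
      · simpa using h2 b hb
    · by_cases hb : b = a
      · rw [hb, h1, cap_of_mem a.2]
      · obtain ⟨d, hd1, hd2⟩ : ∃ d, b ≠ d ∧ (a : Fin 3) ≠ d := by
          revert b; generalize (a : Fin 3) = a; revert a; decide
        rw [csum_eq_of_ne x (Ne.symm hb) hd2 hd1, h1] at h3
        have := h2 d hd2.symm
        have := le_cap R 0 b
        push_cast at this
        linarith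
    · push_cast; linarith

/-- If the half-open segments from the points of `F ⊇ U` towards a point `q` of `U` lie in `U`, then
`U` is connected and dense in `F`. -/
theorem star_isConnected_and_closure {F U : Set E3} {q : E3} (hUF : U ⊆ F) (hq : q ∈ U)
    (h : ∀ x ∈ F, ∀ t ∈ Ioc (0 : ℝ) 1, x + t • (q - x) ∈ U) :
    IsConnected U ∧ F ⊆ closure U := by
  refine ⟨(StarConvex.isPathConnected (a := q) ?_ hq).isConnected, fun x hx => ?_⟩
  · rw [starConvex_iff_segment_subset]
    rintro y hy _ ⟨s, t, hs, ht, hst, rfl⟩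
    rcases hs.eq_or_lt with h0 | h0
    · rw [← h0, zero_add] at hst
      rw [← h0, hst, zero_smul, one_smul, zero_add]; exact hy
    · have := h y (hUF hy) s ⟨h0, by linarith⟩
      have e : s • q + t • y = y + s • (q - y) := by
        rw [eq_sub_of_add_eq' hst]; module
      rw [e]; exact this
  · have hc : ContinuousAt (fun t : ℝ => x + t • (q - x)) 0 := by fun_prop
    have hc' : Tendsto (fun t : ℝ => x + t • (q - x)) (𝓝[>] 0) (𝓝 x) := by
      have := hc.tendsto.mono_left (nhdsWithin_le_nhds (s := Ioi 0))
      simpa using this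
    refine mem_closure_of_tendsto hc' ?_
    filter_upwards [Ioc_mem_nhdsGT (zero_lt_one (α := ℝ))] with t ht
    exact h x hx t ht

theorem lt_combo {u v c t : ℝ} (hu : c ≤ u) (hv : c < v) (ht : t ∈ Ioc (0 : ℝ) 1) :
    c < u + t * (v - u) := by
  nlinarith [ht.1, ht.2, mul_pos ht.1 (sub_pos.2 hv), mul_nonneg (sub_nonneg.2 ht.2) (sub_nonneg.2 hu)]

theorem combo_lt {u v c t : ℝ} (hu : u ≤ c) (hv : v < c) (ht : t ∈ Ioc (0 : ℝ) 1) :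
    u + t * (v - u) < c := by
  nlinarith [ht.1, ht.2, mul_pos ht.1 (sub_pos.2 hv), mul_nonneg (sub_nonneg.2 ht.2) (sub_nonneg.2 hu)]

theorem combo_eq {u v c t : ℝ} (hu : u = c) (hv : v = c) : u + t * (v - u) = c := by
  rw [hu, hv]; ring

theorem csum_combo (x q : E3) (t : ℝ) :
    csum (x + t • (q - x)) = csum x + t * (csum q - csum x) := by
  rw [map_add, map_smul, map_sub, smul_eq_mul]

theorem openCell_isConnected_and_closure (c : FaceLabel k R) :
    IsConnected (openCell c) ∧ closedCell c ⊆ closure (openCell c) := by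
  rcases c with ⟨i, a⟩ | i | a
  · have q1 : ∀ b, b ≠ a → pt (2 * ((i : ℕ) : ℝ)) (2 * ((i : ℕ) : ℝ) + 2) a b = 2 * ((i : ℕ) : ℝ) + 2 :=
      fun b hb => pt_ne _ _ hb
    have q2 : ∀ b, pt (2 * ((i : ℕ) : ℝ)) (2 * ((i : ℕ) : ℝ) + 2) a b < cap R i b := fun b => by
      by_cases hb : b = a
      · rw [hb, pt_same]; linarith [le_cap R i a]
      · rw [q1 b hb]; linarith [le_cap R i b]
    refine star_isConnected_and_closure (q := pt (2 * (i : ℕ)) (2 * ((i : ℕ) : ℝ) + 2) a)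
      (openCell_subset_closedCell _) ⟨pt_same _ _ _, fun b hb => ?_, q2, ?_, fun _ => ?_⟩ ?_
    · rw [q1 b hb]; linarith
    · rw [csum_pt]; linarith
    · rw [csum_pt]; linarith
    · rintro x ⟨h1, h2, h3, h4, h5⟩ t ht
      refine ⟨combo_eq h1 (pt_same _ _ _), fun b hb => lt_combo (h2 b hb)
        (show 2 * ((i : ℕ) : ℝ) < pt _ _ a b by rw [q1 b hb]; linarith) ht,
        fun b => combo_lt (h3 b) (q2 b) ht, ?_, fun hi => ?_⟩
      · rw [csum_combo]
        exact combo_lt h4 (by rw [csum_pt]; linarith) ht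
      · rw [csum_combo]
        exact lt_combo (h5 hi) (by rw [csum_pt]; linarith) ht
  · -- an outer face with a hole is the union of three pieces, each star-shaped about two points
    let U : Fin 3 → Set E3 := fun b => {x | csum x = 6 * (i : ℕ) + 7 ∧
      (∀ b, 2 * ((i : ℕ) : ℝ) < x b) ∧ (∀ b, x b < cap R i b) ∧
      ((i : ℕ) + 1 < k → x b < 2 * ((i : ℕ) : ℝ) + 2)}
    let F : Fin 3 → Set E3 := fun b => {x | csum x = 6 * (i : ℕ) + 7 ∧
      (∀ b, 2 * ((i : ℕ) : ℝ) ≤ x b) ∧ (∀ b, x b ≤ cap R i b) ∧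
      ((i : ℕ) + 1 < k → x b ≤ 2 * ((i : ℕ) : ℝ) + 2)}
    let q : Fin 3 → E3 := fun a => pt (2 * (i : ℕ) + 4) (2 * (i : ℕ) + 3 / 2) a
    have hq : ∀ a b, (b = a ∧ q a b = 2 * (i : ℕ) + 4) ∨
        (b ≠ a ∧ q a b = 2 * (i : ℕ) + 3 / 2) := fun a b => by
      by_cases hb : b = a
      · exact Or.inl ⟨hb, by rw [hb]; exact pt_same _ _ _⟩
      · exact Or.inr ⟨hb, pt_ne _ _ hb⟩
    have hq1 : ∀ a b, 2 * ((i : ℕ) : ℝ) < q a b := fun a b => by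
      rcases hq a b with ⟨-, h⟩ | ⟨-, h⟩ <;> rw [h] <;> linarith
    have hq2 : ∀ a b, q a b < cap R i b := fun a b => by
      have := le_cap R i b
      rcases hq a b with ⟨-, h⟩ | ⟨-, h⟩ <;> rw [h] <;> linarith
    have hq3 : ∀ a, csum (q a) = 6 * (i : ℕ) + 7 := fun a => by
      simp only [q, csum_pt]; ring
    have hq4 : ∀ a b, b ≠ a → q a b < 2 * ((i : ℕ) : ℝ) + 2 := fun a b hb => by
      rcases hq a b with ⟨h, -⟩ | ⟨-, h⟩
      · exact absurd h hb
      · rw [h]; linarith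
    have hqU : ∀ a b, b ≠ a → q a ∈ U b := fun a b hb =>
      ⟨hq3 a, hq1 a, hq2 a, fun _ => hq4 a b hb⟩
    have hstar : ∀ a b, b ≠ a → IsConnected (U b) ∧ F b ⊆ closure (U b) := by
      intro a b hb
      refine star_isConnected_and_closure (q := q a)
        (fun x hx => ⟨hx.1, fun b => (hx.2.1 b).le, fun b => (hx.2.2.1 b).le,
          fun h => (hx.2.2.2 h).le⟩) (hqU a b hb) ?_
      rintro x ⟨h1, h2, h3, h4⟩ t ht
      refine ⟨?_, fun d => lt_combo (h2 d) (hq1 a d) ht, fun d => combo_lt (h3 d) (hq2 a d) ht,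
        fun hi => combo_lt (h4 hi) (hq4 a b hb) ht⟩
      rw [csum_combo]
      exact combo_eq h1 (hq3 a)
    have hU : openCell (Sum.inr (Sum.inl i) : FaceLabel k R) = (U 0 ∪ U 1) ∪ U 2 := by
      ext x
      constructor
      · rintro ⟨h1, h2, h3, h4⟩
        by_cases hi : (i : ℕ) + 1 < k
        · obtain ⟨b, hb⟩ := h4 hi
          have : x ∈ U b := ⟨h1, h2, h3, fun _ => hb⟩
          fin_cases b
          · exact Or.inl (Or.inl this)
          · exact Or.inl (Or.inr this)
          · exact Or.inr this
        · exact Or.inr ⟨h1, h2, h3, fun h => absurd h hi⟩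
      · rintro ((h | h) | h) <;> exact ⟨h.1, h.2.1, h.2.2.1, fun hi => ⟨_, h.2.2.2 hi⟩⟩
    have hF : closedCell (Sum.inr (Sum.inl i) : FaceLabel k R) ⊆ (F 0 ∪ F 1) ∪ F 2 := by
      rintro x ⟨h1, h2, h3, h4⟩
      by_cases hi : (i : ℕ) + 1 < k
      · obtain ⟨b, hb⟩ := h4 hi
        have : x ∈ F b := ⟨h1, h2, h3, fun _ => hb⟩
        fin_cases b
        · exact Or.inl (Or.inl this)
        · exact Or.inl (Or.inr this)
        · exact Or.inr this
      · exact Or.inr ⟨h1, h2, h3, fun h => absurd h hi⟩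
    have s0 := hstar 2 0 (by decide)
    have s1 := hstar 0 1 (by decide)
    have s2 := hstar 1 2 (by decide)
    rw [hU]
    refine ⟨IsConnected.union ⟨q 0, Or.inr (hqU 0 1 (by decide)), hqU 0 2 (by decide)⟩
      (IsConnected.union ⟨q 2, hqU 2 0 (by decide), hqU 2 1 (by decide)⟩ s0.1 s1.1) s2.1, ?_⟩
    rw [closure_union, closure_union]
    exact hF.trans (union_subset_union (union_subset_union s0.2 s1.2) s2.2)
  · have q1 : ∀ b, b ≠ (a : Fin 3) → pt (11 / 2) (1 / 4) a b = 1 / 4 := fun b hb => pt_ne _ _ hb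
    refine star_isConnected_and_closure (q := pt (11 / 2) (1 / 4) a)
      (openCell_subset_closedCell _) ⟨pt_same _ _ _, fun b hb => ?_, ?_⟩ ?_
    · rw [q1 b hb]; norm_num
    · rw [csum_pt]; norm_num
    · rintro x ⟨h1, h2, h3⟩ t ht
      refine ⟨combo_eq h1 (pt_same _ _ _), fun b hb => lt_combo (h2 b hb)
        (show (0 : ℝ) < pt _ _ (a : Fin 3) b by rw [q1 b hb]; norm_num) ht, ?_⟩
      · rw [csum_combo]
        exact combo_lt h3 (by rw [csum_pt]; norm_num) ht

theorem relOpen_openCell (c : FaceLabel k R) :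
    RelOpen (faceNormal c) (faceOffset c) (openCell c) := by
  suffices H : ∀ x ∈ openCell c, ∀ᶠ y in 𝓝 x,
      y ∈ plane (faceNormal c) (faceOffset c) → y ∈ openCell c by
    refine ⟨(openCell_subset_closedCell c).trans (closedCell_subset_plane c), fun x hx => ?_⟩
    obtain ⟨ε, hε, h⟩ := Metric.eventually_nhds_iff_ball.1 (H x hx)
    exact ⟨ε, hε, fun y hy => h y hy.1 hy.2⟩
  rcases c with ⟨i, a⟩ | i | a
  · rintro x ⟨-, h2, h3, h4, h5⟩
    filter_upwards [eventually_all.2 fun b => eventually_imp_distrib_left.2 fun hb =>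
        eventually_lt_coord (h2 b hb), eventually_all.2 fun b => eventually_coord_lt (h3 b),
      eventually_csum_lt h4, eventually_imp_distrib_left.2 fun hi => eventually_lt_csum (h5 hi)]
      with y g2 g3 g4 g5 g1
    exact ⟨g1, g2, g3, g4, g5⟩
  · rintro x ⟨-, h2, h3, h4⟩
    have ev : ∀ᶠ y in 𝓝 x, (i : ℕ) + 1 < k → ∃ b : Fin 3, y b < 2 * ((i : ℕ) : ℝ) + 2 :=
      eventually_imp_distrib_left.2 fun hi => by
        obtain ⟨b, hb⟩ := h4 hi
        filter_upwards [eventually_coord_lt hb] with y hy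
        exact ⟨b, hy⟩
    filter_upwards [eventually_all.2 fun b => eventually_lt_coord (h2 b),
      eventually_all.2 fun b => eventually_coord_lt (h3 b), ev] with y g2 g3 g4 g1
    exact ⟨g1, g2, g3, g4⟩
  · rintro x ⟨-, h2, h3⟩
    filter_upwards [eventually_all.2 fun b => eventually_imp_distrib_left.2 fun hb =>
        eventually_lt_coord (h2 b hb), eventually_csum_lt h3] with y g2 g3 g1
    exact ⟨g1, g2, g3⟩

theorem isClosed_closedCell (c : FaceLabel k R) : IsClosed (closedCell c) := by
  have hco : ∀ b : Fin 3, Continuous fun x : E3 => x b := fun b =>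
    (EuclideanSpace.proj (𝕜 := ℝ) b).continuous
  refine isClosed_of_closure_subset fun x hx => ?_
  have mem : ∀ C : Set E3, IsClosed C → (∀ y ∈ closedCell c, y ∈ C) → x ∈ C := fun C hC h =>
    hC.closure_subset_iff.2 h hx
  rcases c with ⟨i, a⟩ | i | a
  · exact ⟨mem _ (isClosed_eq (hco a) continuous_const) fun y hy => hy.1,
      fun b hb => mem _ (isClosed_le continuous_const (hco b)) fun y hy => hy.2.1 b hb,
      fun b => mem _ (isClosed_le (hco b) continuous_const) fun y hy => hy.2.2.1 b,
      mem _ (isClosed_le csum.continuous continuous_const) fun y hy => hy.2.2.2.1,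
      fun hi => mem _ (isClosed_le continuous_const csum.continuous) fun y hy => hy.2.2.2.2 hi⟩
  · refine ⟨mem _ (isClosed_eq csum.continuous continuous_const) fun y hy => hy.1,
      fun b => mem _ (isClosed_le continuous_const (hco b)) fun y hy => hy.2.1 b,
      fun b => mem _ (isClosed_le (hco b) continuous_const) fun y hy => hy.2.2.1 b, fun hi => ?_⟩
    have := mem (⋃ b : Fin 3, {y : E3 | y b ≤ 2 * ((i : ℕ) : ℝ) + 2})
      (isClosed_iUnion_of_finite fun b => isClosed_le (hco b) continuous_const)
      fun y hy => mem_iUnion.2 (hy.2.2.2 hi)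
    obtain ⟨b, hb⟩ := mem_iUnion.1 this
    exact ⟨b, hb⟩
  · exact ⟨mem _ (isClosed_eq (hco a) continuous_const) fun y hy => hy.1,
      fun b hb => mem _ (isClosed_le continuous_const (hco b)) fun y hy => hy.2.1 b hb,
      mem _ (isClosed_le csum.continuous continuous_const) fun y hy => hy.2.2⟩

/-- Each point of the open cells can be left in a direction pointing out of the chain. -/
theorem openCell_subset_frontier (c : FaceLabel k R) (hk : 0 < k) :
    openCell c ⊆ frontier (chain k R) := by
  intro x hx
  rw [(isClosed_chain k R).frontier_eq]
  refine ⟨closedCell_subset_chain c hk (openCell_subset_closedCell c hx), fun hxi => ?_⟩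
  have out : ∀ w : E3, (∀ᶠ t in 𝓝[>] (0 : ℝ), x + t • w ∉ chain k R) → False := fun w hw => by
    obtain ⟨t, h1, h2⟩ := (hw.and (eventually_mem_of_isOpen isOpen_interior hxi w)).exists
    exact h1 (interior_subset h2)
  have ev : ∀ (w : E3) {p : E3 → Prop}, (∀ᶠ y in 𝓝 x, p y) →
      ∀ᶠ t in 𝓝[>] (0 : ℝ), p (x + t • w) := fun w p hp => by
    have hc : ContinuousAt (fun t : ℝ => x + t • w) 0 := by fun_prop
    have hp' : ∀ᶠ y in 𝓝 (x + (0 : ℝ) • w), p y := by simpa using hp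
    exact (hc.eventually hp').filter_mono nhdsWithin_le_nhds
  rcases c with ⟨i, a⟩ | i | a
  · obtain ⟨h1, h2, h3, h4, h5⟩ := hx
    refine out (pt (-1) 0 a) ?_
    have evs : ∀ᶠ y in 𝓝 x, 0 < (i : ℕ) → 6 * ((i : ℕ) : ℝ) + 1 < csum y :=
      eventually_imp_distrib_left.2 fun hi => eventually_lt_csum (h5 hi)
    filter_upwards [ev (pt (-1) 0 a) evs, self_mem_nhdsWithin] with t ht1 ht0 hmem
    have ht0' : 0 < t := ht0
    obtain ⟨j, hj, hjm⟩ := mem_chain.1 hmem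
    obtain ⟨g1, g2, g3⟩ := mem_piece.1 hjm
    have hja := g1 a
    rw [coord_add_smul, pt_same, h1] at hja
    have hji : j < i := by
      have : (j : ℝ) < (i : ℕ) := by linarith
      exact_mod_cast this
    have h6 := ht1 (by omega)
    have : (j : ℝ) + 1 ≤ (i : ℕ) := by exact_mod_cast hji
    linarith
  · obtain ⟨h1, h2, h3, h4⟩ := hx
    obtain ⟨b, hb⟩ : ∃ b, (i : ℕ) + 1 < k → x b < 2 * ((i : ℕ) : ℝ) + 2 := by
      by_cases hi : (i : ℕ) + 1 < k
      · exact (h4 hi).imp fun b hb _ => hb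
      · exact ⟨0, fun h => absurd h hi⟩
    refine out (pt 1 0 b) ?_
    have evb : ∀ᶠ y in 𝓝 x, (i : ℕ) + 1 < k → y b < 2 * ((i : ℕ) : ℝ) + 2 :=
      eventually_imp_distrib_left.2 fun hi => eventually_coord_lt (hb hi)
    filter_upwards [ev (pt 1 0 b) evb, self_mem_nhdsWithin] with t ht1 ht0 hmem
    have ht0' : 0 < t := ht0
    obtain ⟨j, hj, hjm⟩ := mem_chain.1 hmem
    obtain ⟨g1, g2, g3⟩ := mem_piece.1 hjm
    rw [csum_add_smul, csum_pt, h1] at g3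
    have hji : (i : ℕ) < j := by
      have : ((i : ℕ) : ℝ) < j := by linarith
      exact_mod_cast this
    have h6 := ht1 (by omega)
    have : ((i : ℕ) : ℝ) + 1 ≤ j := by exact_mod_cast hji
    linarith [g1 b]
  · obtain ⟨h1, h2, h3⟩ := hx
    obtain ⟨b, d, hab, had, hbd⟩ := exists_others (a : Fin 3)
    have hxb : x b < 2 := by
      rw [csum_eq_of_ne x hab had hbd, h1] at h3
      linarith [h2 d had.symm]
    refine out (pt 1 0 a) ?_
    filter_upwards [ev (pt 1 0 a) (eventually_coord_lt hxb), self_mem_nhdsWithin]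
      with t ht1 ht0 hmem
    have ht0' : 0 < t := ht0
    obtain ⟨j, hj, hjm⟩ := mem_chain.1 hmem
    obtain ⟨g1, g2, g3⟩ := mem_piece.1 hjm
    have hj0 : j = 0 := by
      by_contra h
      have : (1 : ℝ) ≤ j := by exact_mod_cast Nat.one_le_iff_ne_zero.2 h
      linarith [g1 b]
    have := g2 a
    rw [hj0, cap_of_mem a.2, coord_add_smul, h1, pt_same] at this
    linarith

theorem frontier_chain (hk : 0 < k) :
    frontier (chain k R) = ⋃ c : FaceLabel k R, closedCell c := by
  refine Subset.antisymm (fun x hx => ?_) (iUnion_subset fun c => ?_)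
  · rw [(isClosed_chain k R).frontier_eq] at hx
    obtain ⟨hxP, hxi⟩ := hx
    obtain ⟨i, hi, hxp⟩ := mem_chain.1 hxP
    obtain ⟨h1, h2, h3⟩ := mem_piece.1 hxp
    rw [mem_iUnion]
    by_cases hl : ∃ a, x a = 2 * (i : ℝ)
    · obtain ⟨a, ha⟩ := hl
      refine ⟨.inl (⟨i, hi⟩, a), ha, fun b _ => h1 b, h2, h3, fun hi0 => ?_⟩
      -- otherwise the point is interior to the preceding piece
      by_contra hlt
      obtain ⟨m, rfl⟩ : ∃ m, i = m + 1 := ⟨i - 1, by simp at hi0; omega⟩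
      push Not at hlt
      push_cast at hlt h1
      refine hxi (interior_piece_subset (show m < k by omega)
        (mem_interior_piece (fun b => ?_) (fun b => ?_) ?_))
      · linarith [h1 b]
      · obtain ⟨d, e, hd, he, hde⟩ := exists_others b
        rw [csum_eq_of_ne x hd he hde] at hlt
        linarith [h1 d, h1 e, le_cap R m b]
      · linarith
    by_cases hs : csum x = 6 * (i : ℝ) + 7
    · refine ⟨.inr (.inl ⟨i, hi⟩), hs, h1, h2, fun hi1 => ?_⟩
      by_contra hcon
      push Not at hcon
      simp only at hcon hi1
      refine hxi (interior_piece_subset hi1 (mem_interior_piece (fun b => ?_) (fun b => ?_) ?_))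
      · push_cast; linarith [hcon b]
      · obtain ⟨d, e, hd, he, hde⟩ := exists_others b
        rw [csum_eq_of_ne x hd he hde] at h3
        have := le_cap R (i + 1) b
        push_cast at this
        linarith [hcon d, hcon e]
      · push_cast; linarith
    by_cases hc : ∃ a, x a = cap R i a
    · obtain ⟨a, ha⟩ := hc
      have haR : i = 0 ∧ a ∈ R := by
        by_contra hn
        rw [cap_of_not hn] at ha
        obtain ⟨d, e, hd, he, hde⟩ := exists_others a
        rw [csum_eq_of_ne x hd he hde] at h3
        linarith [h1 d, h1 e]
      obtain ⟨rfl, haR⟩ := haR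
      refine ⟨.inr (.inr ⟨a, haR⟩), by rw [← cap_of_mem haR, ← ha], fun b _ => ?_, ?_⟩
      · simpa using h1 b
      · simpa using h3
    push Not at hl hc
    exact absurd (interior_piece_subset hi (mem_interior_piece
      (fun a => lt_of_le_of_ne (h1 a) (hl a).symm) (fun a => lt_of_le_of_ne (h2 a) (hc a))
      (lt_of_le_of_ne h3 hs))) hxi
  · exact (openCell_isConnected_and_closure c).2.trans
      (isClosed_frontier.closure_subset_iff.2 (openCell_subset_frontier c hk))

theorem plane_injective (c d : FaceLabel k R)
    (h : plane (faceNormal c) (faceOffset c) = plane (faceNormal d) (faceOffset d)) : c = d := by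
  have key := mem_plane_iff_of_plane_eq h
  -- two coordinate planes
  have coord : ∀ (a b : Fin 3) (s t : ℝ), (∀ x : E3, x a = s ↔ x b = t) → a = b ∧ s = t := by
    intro a b s t hst
    have hab : a = b := by
      by_contra hab
      have := (hst (pt s (t + 1) a)).1 (pt_same _ _ _)
      rw [pt_ne _ _ (Ne.symm hab)] at this
      linarith
    subst hab
    exact ⟨rfl, by have := (hst (pt s 0 a)).1 (pt_same _ _ _); rwa [pt_same] at this⟩
  -- a coordinate plane and a plane `csum x = t`
  have mixed : ∀ (a : Fin 3) (s t : ℝ), ¬ ∀ x : E3, x a = s ↔ csum x = t := by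
    intro a s t hst
    have := (hst (pt s ((t - s) / 2 + 1) a)).1 (pt_same _ _ _)
    rw [csum_pt] at this
    linarith
  have parity : ∀ i : ℕ, 2 * (i : ℝ) ≠ 11 / 2 := by
    intro i hi
    have : (4 * i : ℝ) = 11 := by linarith
    have : 4 * i = 11 := by exact_mod_cast this
    omega
  rcases c with ⟨i, a⟩ | i | a <;> rcases d with ⟨j, b⟩ | j | b
  · obtain ⟨rfl, hij⟩ := coord a b _ _ key
    have h1 : 2 * ((i : ℕ) : ℝ) = 2 * (j : ℕ) := hij
    have : (i : ℕ) = j := by exact_mod_cast (by linarith : ((i : ℕ) : ℝ) = (j : ℕ))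
    rw [Fin.ext this]
  · exact absurd key (mixed a _ _)
  · exact absurd (coord a b _ _ key).2 (parity i)
  · exact absurd (fun x => (key x).symm) (mixed b _ _)
  · have h1 : csum (pt (6 * ((i : ℕ) : ℝ) + 7) 0 0) = 6 * ((j : ℕ) : ℝ) + 7 :=
      (key _).1 (by change csum _ = 6 * ((i : ℕ) : ℝ) + 7; rw [csum_pt]; ring)
    rw [csum_pt] at h1
    have : (i : ℕ) = j := by exact_mod_cast (by linarith : ((i : ℕ) : ℝ) = (j : ℕ))
    rw [Fin.ext this]
  · exact absurd (fun x => (key x).symm) (mixed b _ _)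
  · exact absurd (coord a b _ _ key).2.symm (parity j)
  · exact absurd key (mixed a _ _)
  · rw [Subtype.ext (coord a b _ _ key).1]

theorem isPlanarRegion_closedCell (hk : 0 < k) (c : FaceLabel k R) :
    IsPlanarRegion (frontier (chain k R)) (closedCell c) :=
  isPlanarRegion_of_relOpen (faceNormal_ne_zero c) (relOpen_openCell c)
    (openCell_isConnected_and_closure c).1 (openCell_subset_closedCell c)
    (openCell_isConnected_and_closure c).2 (frontier_chain hk ▸ subset_iUnion _ c)

theorem faces_chain (hk : 0 < k) : faces (chain k R) = range (closedCell (k := k) (R := R)) := by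
  ext F
  rw [faces, mem_ofPred_eq, IsFace, maximal_planarRegion_iff_of_iUnion faceNormal_ne_zero
    (frontier_chain hk) isClosed_closedCell closedCell_subset_plane (isPlanarRegion_closedCell hk)
    plane_injective, mem_range]
  exact ⟨fun ⟨c, h⟩ => ⟨c, h.symm⟩, fun ⟨c, h⟩ => ⟨c, h.symm⟩⟩

theorem closedCell_injective (hk : 0 < k) :
    Function.Injective (closedCell (k := k) (R := R)) := by
  intro c d h
  refine plane_injective c d ?_
  rw [← affineSpan_eq_plane (faceNormal_ne_zero c) (closedCell_subset_plane c)
      (isPlanarRegion_closedCell hk c).planar, h,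
    affineSpan_eq_plane (faceNormal_ne_zero d) (closedCell_subset_plane d)
      (isPlanarRegion_closedCell hk d).planar]

theorem encard_faces_chain (hk : 0 < k) :
    (faces (chain k R)).encard = ((4 * k + R.card : ℕ) : ℕ∞) := by
  rw [faces_chain hk, ← image_univ, (closedCell_injective hk).encard_image, encard_univ,
    ENat.card_eq_coe_fintype_card]
  simp only [Fintype.card_sum, Fintype.card_prod, Fintype.card_fin, Fintype.card_coe]
  congr 1
  ring

theorem isOriented_chain (hk : 0 < k) : IsOriented 4 (chain k R) := by
  let n : Fin 4 → E3 := Fin.snoc (fun a : Fin 3 => pt 1 0 a) (pt 1 1 0)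
  have hn : ∀ j, n j ≠ 0 := by
    intro j hj
    have h0 : csum (n j) = 0 := by rw [hj, map_zero]
    induction j using Fin.lastCases with
    | last => simp only [n, Fin.snoc_last, csum_pt] at h0; norm_num at h0
    | cast a => simp only [n, Fin.snoc_castSucc, csum_pt] at h0; norm_num at h0
  have hin : ∀ (a : Fin 3) (w : E3), inner ℝ (pt 1 0 a) w = w a := fun a w => by
    fin_cases a <;> simp [PiLp.inner_apply, pt]
  have hin' : ∀ w : E3, inner ℝ (pt 1 1 0) w = csum w := fun w => by
    simp [PiLp.inner_apply, Fin.sum_univ_three, pt, csum_apply]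
  refine ⟨fun j => (‖n j‖⁻¹ : ℝ) • n j, fun j => norm_smul_inv_norm (𝕜 := ℝ) (hn j), ?_⟩
  intro F hF
  rw [faces_chain hk] at hF
  obtain ⟨c, rfl⟩ := hF
  suffices H : ∃ j, ∀ w, faceNormal c w = 0 → inner ℝ (n j) w = 0 by
    obtain ⟨j, hj⟩ := H
    refine ⟨j, fun w hw => ?_⟩
    rw [inner_smul_left, hj w (vectorSpan_le_ker (closedCell_subset_plane c) hw), mul_zero]
  rcases c with ⟨i, a⟩ | i | a
  · refine ⟨a.castSucc, fun w hw => ?_⟩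
    simp only [n, Fin.snoc_castSucc, hin]
    exact hw
  · refine ⟨Fin.last 3, fun w hw => ?_⟩
    simp only [n, Fin.snoc_last, hin']
    exact hw
  · refine ⟨(a : Fin 3).castSucc, fun w hw => ?_⟩
    simp only [n, Fin.snoc_castSucc, hin]
    exact hw

/-! ### Every piece of the chain needs its own guard -/

/-- A constraint that is tight at a point `w` of only one piece holds at every point seen by `w`. -/
theorem pieceOffset_le_of_segment_subset {i : ℕ} {w q : E3}
    (hw : ∀ j, w ∈ piece R j → j = i) (hseg : segment ℝ q w ⊆ chain k R)
    {c : Fin 3 ⊕ (Fin 3 ⊕ Unit)} (hc : pieceNormal c w = pieceOffset R i c) :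
    pieceOffset R i c ≤ pieceNormal c q := by
  by_contra hlt
  push Not at hlt
  have ev1 : ∀ᶠ t in 𝓝[>] (0 : ℝ), w + t • (q - w) ∈
      (⋃ j : {j : Fin k // (j : ℕ) ≠ i}, piece R (j : Fin k))ᶜ := by
    refine eventually_mem_of_isOpen (isClosed_iUnion_of_finite fun j =>
      isClosed_halfspaces _ _).isOpen_compl ?_ _
    rw [mem_compl_iff, mem_iUnion]
    rintro ⟨j, hj⟩
    exact j.2 (hw _ hj)
  obtain ⟨t, ht1, ht0, htl⟩ := (ev1.and (Ioo_mem_nhdsGT (zero_lt_one (α := ℝ)))).exists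
  have hmem : w + t • (q - w) ∈ chain k R :=
    hseg ⟨t, 1 - t, ht0.le, by linarith, by ring, by module⟩
  obtain ⟨j, hj, hjm⟩ := mem_chain.1 hmem
  by_cases hji : j = i
  · have h1 := hjm c
    rw [hji, map_add, map_smul, map_sub, hc, smul_eq_mul] at h1
    nlinarith
  · exact ht1 (mem_iUnion.2 ⟨⟨⟨j, hj⟩, hji⟩, hjm⟩)

theorem segment_subset_of_visible {x y : E3} (h : Visible (chain k R) x y) :
    segment ℝ x y ⊆ chain k R := fun z hz => by
  have := h z hz
  rwa [(isClosed_chain k R).isOpen_compl.interior_eq, notMem_compl_iff] at this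

/-- From a relative interior point of a face one can move a little in every direction of its
plane. -/
theorem eventually_mem_closedCell (hk : 0 < k) {c : FaceLabel k R} {x q : E3}
    (hx : x ∈ intrinsicInterior ℝ (closedCell c)) (hq : q ∈ plane (faceNormal c) (faceOffset c)) :
    ∀ᶠ t in 𝓝 (0 : ℝ), x + t • (q - x) ∈ closedCell c := by
  have hro := relOpen_intrinsicInterior (faceNormal_ne_zero c) (closedCell_subset_plane c)
    (isPlanarRegion_closedCell hk c).planar
  obtain ⟨ε, hε, hb⟩ := hro.2 x hx
  have hc : ContinuousAt (fun t : ℝ => x + t • (q - x)) 0 := by fun_prop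
  filter_upwards [hc.eventually_mem (isOpen_ball.mem_nhds
    (by simpa using hε : x + (0 : ℝ) • (q - x) ∈ ball x ε))] with t ht
  refine intrinsicInterior_subset (hb ⟨ht, add_mem_plane (hro.1 hx) ?_⟩)
  have h1 : faceNormal c x = faceOffset c := hro.1 hx
  have h2 : faceNormal c q = faceOffset c := hq
  rw [map_smul, map_sub, h1, h2, sub_self, smul_zero]

theorem lt_csum_of_mem_intrinsicInterior (hk : 0 < k) {i : Fin k} {a : Fin 3} (hi : 0 < (i : ℕ))
    {x : E3} (hx : x ∈ intrinsicInterior ℝ (closedCell (.inl (i, a) : FaceLabel k R))) :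
    6 * ((i : ℕ) : ℝ) + 1 < csum x := by
  by_contra hle
  push Not at hle
  have ev := eventually_mem_closedCell hk hx
    (q := pt (2 * (i : ℕ)) (2 * (i : ℕ) + 2) a) (pt_same _ _ _)
  obtain ⟨t, ht, ht0⟩ :=
    ((ev.filter_mono nhdsWithin_le_nhds).and (self_mem_nhdsWithin (s := Iio 0))).exists
  have ht0' : t < 0 := ht0
  have h1 := ht.2.2.2.2 hi
  rw [csum_combo, csum_pt] at h1
  nlinarith

theorem exists_coord_lt_of_mem_intrinsicInterior (hk : 0 < k) {i : Fin k} (hi : (i : ℕ) + 1 < k)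
    {x : E3} (hx : x ∈ intrinsicInterior ℝ (closedCell (.inr (.inl i) : FaceLabel k R))) :
    ∃ b : Fin 3, x b < 2 * ((i : ℕ) : ℝ) + 2 := by
  by_contra hle
  push Not at hle
  -- otherwise one could move towards the centre of the hole
  have ev := eventually_mem_closedCell hk hx
    (q := pt (2 * (i : ℕ) + 7 / 3) (2 * (i : ℕ) + 7 / 3) 0) (by
      change csum _ = 6 * ((i : ℕ) : ℝ) + 7
      rw [csum_pt]; ring)
  obtain ⟨t, ht, ht0⟩ :=
    ((ev.filter_mono nhdsWithin_le_nhds).and (Ioc_mem_nhdsGT (zero_lt_one (α := ℝ)))).exists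
  obtain ⟨b, hb⟩ := ht.2.2.2 hi
  have hq : pt (2 * ((i : ℕ) : ℝ) + 7 / 3) (2 * (i : ℕ) + 7 / 3) 0 b = 2 * (i : ℕ) + 7 / 3 := by
    simp [pt]
  refine absurd hb (not_le.2 (lt_combo (hle b) ?_ ht0))
  change 2 * ((i : ℕ) : ℝ) + 2 < pt _ _ 0 b
  rw [hq]; linarith

/-- The index of the piece to which a face belongs. -/
def owner : FaceLabel k R → ℕ
  | .inl p => p.1
  | .inr (.inl i) => i
  | .inr (.inr _) => 0

theorem owner_lt (hk : 0 < k) (c : FaceLabel k R) : owner c < k := by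
  rcases c with ⟨i, a⟩ | i | a
  · exact i.2
  · exact i.2
  · exact hk

theorem witness_mem_chain {i : ℕ} (hi : 0 < i) (hik : i < k) (a : Fin 3) :
    pt (2 * (i : ℝ) + 7) (2 * i) a ∈ chain k R := by
  have hcap : ∀ b, cap R i b = 2 * i + 8 := fun b => cap_of_not fun h => hi.ne' h.1
  refine mem_chain.2 ⟨i, hik, mem_piece.2 ⟨fun b => ?_, fun b => ?_, ?_⟩⟩
  · by_cases hb : b = a
    · rw [hb, pt_same]; linarith
    · rw [pt_ne _ _ hb]
  · rw [hcap]
    by_cases hb : b = a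
    · rw [hb, pt_same]; linarith
    · rw [pt_ne _ _ hb]; linarith
  · rw [csum_pt]; linarith

/-- An outer vertex of a piece is seen only by the faces of that piece and by one particular face of
the preceding piece. -/
theorem owner_of_sees_witness (hk : 0 < k) {i : ℕ} (hi : 0 < i) (a : Fin 3)
    {c : FaceLabel k R} {q : E3} (hq : q ∈ intrinsicInterior ℝ (closedCell c))
    (hseg : segment ℝ q (pt (2 * (i : ℝ) + 7) (2 * i) a) ⊆ chain k R) :
    owner c = i ∨ ∃ j : Fin k, (j : ℕ) + 1 = i ∧ c = .inl (j, a) := by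
  obtain ⟨b, d, hab, had, hbd⟩ := exists_others a
  set w := pt (2 * (i : ℝ) + 7) (2 * i) a with hw
  have hwa : w a = 2 * i + 7 := pt_same _ _ _
  have hwb : w b = 2 * i := pt_ne _ _ hab.symm
  have hwd : w d = 2 * i := pt_ne _ _ had.symm
  have hws : csum w = 6 * i + 7 := by rw [hw, csum_pt]; ring
  have huniq : ∀ j, w ∈ piece R j → j = i := by
    intro j hj
    obtain ⟨g1, -, g3⟩ := mem_piece.1 hj
    have h1 := g1 b
    rw [hwb] at h1
    rw [hws] at g3
    have e1 : (j : ℝ) ≤ i := by linarith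
    have e2 : (i : ℝ) ≤ j := by linarith
    exact_mod_cast le_antisymm e1 e2
  have tb : 2 * (i : ℝ) ≤ q b := pieceOffset_le_of_segment_subset huniq hseg (c := .inl b) hwb
  have td : 2 * (i : ℝ) ≤ q d := pieceOffset_le_of_segment_subset huniq hseg (c := .inl d) hwd
  have ts : csum q ≤ 6 * i + 7 := by
    have h1 : -(6 * (i : ℝ) + 7) ≤ -(csum q) :=
      pieceOffset_le_of_segment_subset huniq hseg (c := .inr (.inr ())) (congrArg Neg.neg hws)
    linarith
  have hsum : csum q = q a + q b + q d := csum_eq_of_ne q hab had hbd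
  have hi1 : (1 : ℝ) ≤ i := by exact_mod_cast hi
  have hqc := intrinsicInterior_subset hq
  have hcase : ∀ j : ℕ, j < i → 4 * (i : ℝ) + 2 * j ≤ 6 * j + 7 → j + 1 = i := by
    intro j hji h
    by_contra hne
    have : (j : ℝ) + 2 ≤ i := by exact_mod_cast (show j + 2 ≤ i by omega)
    linarith
  rcases c with ⟨j, e⟩ | j | e
  · rcases lt_trichotomy (j : ℕ) i with hlt | heq | hgt
    · obtain ⟨g1, g2, -, g4, -⟩ := hqc
      have hji : ((j : ℕ) : ℝ) < i := by exact_mod_cast hlt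
      have hea : e = a := by
        by_contra hne
        have : e = b ∨ e = d := eq_or_eq_of_ne hab had hbd hne
        rcases this with rfl | rfl <;> linarith
      subst hea
      exact Or.inr ⟨j, hcase j hlt (by linarith), rfl⟩
    · exact Or.inl heq
    · have h1 := lt_csum_of_mem_intrinsicInterior hk (by omega) hq
      have : (i : ℝ) + 1 ≤ (j : ℕ) := by exact_mod_cast hgt
      linarith
  · obtain ⟨g1, g2, -, -⟩ := hqc
    have hji : ((j : ℕ) : ℝ) ≤ i := by linarith
    rcases (show (j : ℕ) ≤ i by exact_mod_cast hji).lt_or_eq with hlt | heq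
    · -- near `q`, the segment from `q` is outside the chain
      exfalso
      have hj1 : (j : ℕ) + 1 = i := hcase j hlt (by linarith [g2 a])
      have hj1' : ((j : ℕ) : ℝ) + 1 = i := by exact_mod_cast hj1
      by_cases hik : i < k
      · obtain ⟨b', hb'⟩ := exists_coord_lt_of_mem_intrinsicInterior hk (by omega) hq
        have hba : b' = a := by
          by_contra hne
          have : b' = b ∨ b' = d := eq_or_eq_of_ne hab had hbd hne
          rcases this with rfl | rfl <;> linarith
        rw [hba] at hb'
        have hc : ContinuousAt (fun t : ℝ => q + t • (w - q)) 0 := by fun_prop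
        have ev : ∀ᶠ t in 𝓝[>] (0 : ℝ), (q + t • (w - q)) a < 2 * ((j : ℕ) : ℝ) + 2 :=
          (hc.eventually (by simpa using eventually_coord_lt hb')).filter_mono nhdsWithin_le_nhds
        obtain ⟨t, ht, ht0, ht1⟩ :=
          (ev.and (Ioc_mem_nhdsGT (zero_lt_one (α := ℝ)))).exists
        have hmem : q + t • (w - q) ∈ chain k R :=
          hseg ⟨1 - t, t, by linarith, ht0.le, by ring, by module⟩
        obtain ⟨m, hm, hmm⟩ := mem_chain.1 hmem
        obtain ⟨f1, -, f3⟩ := mem_piece.1 hmm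
        have f1a := f1 a
        rw [csum_combo, g1, hws] at f3
        have hmj : (m : ℝ) < (j : ℕ) + 1 := by linarith
        have hmj' : m ≤ (j : ℕ) := by
          have : m < (j : ℕ) + 1 := by exact_mod_cast hmj
          omega
        have hmj'' : (m : ℝ) ≤ (j : ℕ) := by exact_mod_cast hmj'
        nlinarith
      · -- there is no such piece in the chain
        have hwm : w ∈ chain k R := hseg (right_mem_segment ℝ q w)
        obtain ⟨m, hm, hmm⟩ := mem_chain.1 hwm
        have := huniq m hmm
        omega
    · exact Or.inl heq
  · exfalso
    obtain ⟨g1, g2, g3⟩ := hqc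
    by_cases hea : (e : Fin 3) = a
    · rw [hea] at g1
      linarith
    · have hqa : 0 ≤ q a := g2 a (Ne.symm hea)
      have : (e : Fin 3) = b ∨ (e : Fin 3) = d := eq_or_eq_of_ne hab had hbd hea
      rcases this with h | h <;> rw [h] at g1 <;> linarith

/-- The midpoint of an outer edge of the first piece. -/
theorem base_witness_mem_chain (hk : 0 < k) : pt 0 (7 / 2) 2 ∈ chain k R := by
  refine mem_chain.2 ⟨0, hk, mem_piece.2 ⟨fun b => ?_, fun b => ?_, ?_⟩⟩
  · by_cases hb : b = 2
    · rw [hb, pt_same]; simp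
    · rw [pt_ne _ _ hb]; norm_num
  · have := le_cap R 0 b
    push_cast at this
    by_cases hb : b = 2
    · rw [hb] at this ⊢
      rw [pt_same]; linarith
    · rw [pt_ne _ _ hb]; linarith
  · rw [csum_pt]; norm_num

theorem owner_of_sees_base_witness (hk : 0 < k) {c : FaceLabel k R} {q : E3}
    (hq : q ∈ intrinsicInterior ℝ (closedCell c))
    (hseg : segment ℝ q (pt 0 (7 / 2) 2) ⊆ chain k R) : owner c = 0 := by
  have hw2 : pt 0 (7 / 2) 2 2 = 0 := pt_same _ _ _
  have hws : csum (pt 0 (7 / 2) 2) = 7 := by rw [csum_pt]; norm_num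
  have huniq : ∀ j, pt 0 (7 / 2) 2 ∈ piece R j → j = 0 := by
    intro j hj
    have h1 := (mem_piece.1 hj).1 2
    rw [hw2] at h1
    have : (j : ℝ) ≤ 0 := by linarith
    exact_mod_cast le_antisymm this (Nat.cast_nonneg j)
  have ts : csum q ≤ 7 := by
    have h1 : -(6 * ((0 : ℕ) : ℝ) + 7) ≤ -(csum q) :=
      pieceOffset_le_of_segment_subset huniq hseg (c := .inr (.inr ())) (by
        change -(csum _) = -(6 * ((0 : ℕ) : ℝ) + 7)
        rw [hws]; simp)
    push_cast at h1
    linarith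
  rcases c with ⟨j, e⟩ | j | e
  · by_contra hne
    have hj : 0 < (j : ℕ) := Nat.pos_of_ne_zero hne
    have h1 := lt_csum_of_mem_intrinsicInterior hk hj hq
    have : (1 : ℝ) ≤ (j : ℕ) := by exact_mod_cast hj
    linarith
  · by_contra hne
    have hj : 0 < (j : ℕ) := Nat.pos_of_ne_zero hne
    have h1 : csum q = 6 * (j : ℕ) + 7 := (intrinsicInterior_subset hq).1
    have : (1 : ℝ) ≤ (j : ℕ) := by exact_mod_cast hj
    linarith
  · rfl

/-- If a piece without guards forces three guards on its predecessor, there are at least as many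
guards as pieces. -/
theorem le_sum_of_zero_imp_three_le (n : ℕ → ℕ) (h0 : 0 < k → 1 ≤ n 0)
    (h : ∀ i, i + 1 < k → n (i + 1) = 0 → 3 ≤ n i) : k ≤ ∑ i ∈ Finset.range k, n i := by
  have key : ∀ m, m + 1 ≤ k → m + 1 ≤ ∑ i ∈ Finset.range (m + 1), n i ∧
      m + n m ≤ ∑ i ∈ Finset.range (m + 1), n i := by
    intro m
    induction m with
    | zero => intro hm; simpa using h0 hm
    | succ m ih =>
      intro hm
      have ih := ih (by omega)
      have hz := h m (by omega)
      rw [Finset.sum_range_succ]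
      by_cases hn : n (m + 1) = 0
      · have := hz hn
        omega
      · omega
  rcases k with _ | m
  · exact Nat.zero_le _
  · exact (key m le_rfl).1

/-- Necessity: a chain of `k` pieces needs `k` open face guards. -/
theorem le_encard_of_guards_chain (hk : 0 < k) {G : Set (Set E3)}
    (hG : OpenFaceGuards (chain k R) G) : (k : ℕ∞) ≤ G.encard := by
  classical
  let L : Finset (FaceLabel k R) := Finset.univ.filter fun c => closedCell c ∈ G
  have hL : ∀ c, c ∈ L ↔ closedCell c ∈ G := fun c => by simp [L]
  have hsee : ∀ w ∈ chain k R, ∃ c ∈ L, ∃ q ∈ intrinsicInterior ℝ (closedCell c),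
      segment ℝ q w ⊆ chain k R := by
    intro w hw
    have hg : w ∈ visibleRegion (chain k R) (⋃ F ∈ G, intrinsicInterior ℝ F) := by
      rw [hG.2]; exact hw
    obtain ⟨q, hq, hvis⟩ := hg
    obtain ⟨F, hF, hqF⟩ := mem_iUnion₂.1 hq
    have hFf := hG.1 hF
    rw [faces_chain hk] at hFf
    obtain ⟨c, rfl⟩ := hFf
    exact ⟨c, (hL c).2 hF, q, hqF, segment_subset_of_visible hvis⟩
  let n : ℕ → ℕ := fun i => (L.filter fun c => owner c = i).card
  have hsum : L.card = ∑ i ∈ Finset.range k, n i :=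
    Finset.card_eq_sum_card_fiberwise fun c _ => Finset.mem_coe.2 (Finset.mem_range.2 (owner_lt hk c))
  have hkL : k ≤ L.card := by
    rw [hsum]
    refine le_sum_of_zero_imp_three_le n (fun _ => ?_) fun i hi hz => ?_
    · obtain ⟨c, hc, q, hq, hseg⟩ := hsee _ (base_witness_mem_chain hk)
      exact Finset.card_pos.2
        ⟨c, Finset.mem_filter.2 ⟨hc, owner_of_sees_base_witness hk hq hseg⟩⟩
    · -- the three outer vertices are seen by three different faces of the predecessor
      have hmem : ∀ a : Fin 3, (Sum.inl (⟨i, by omega⟩, a) : FaceLabel k R) ∈ L := by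
        intro a
        obtain ⟨c, hc, q, hq, hseg⟩ :=
          hsee _ (witness_mem_chain (R := R) (Nat.succ_pos i) hi a)
        rcases owner_of_sees_witness hk (Nat.succ_pos i) a hq hseg with h | ⟨j, hj, rfl⟩
        · exact absurd hz (Finset.card_pos.2 ⟨c, Finset.mem_filter.2 ⟨hc, h⟩⟩).ne'
        · have : j = ⟨i, by omega⟩ := Fin.ext (by simpa using hj)
          rwa [← this]
      let emb : Fin 3 ↪ FaceLabel k R :=
        ⟨fun a => Sum.inl (⟨i, by omega⟩, a), fun a b hab => by simpa using hab⟩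
      calc 3 = (Finset.univ.map emb).card := by simp
        _ ≤ n i := Finset.card_le_card fun c hc => by
          obtain ⟨a, -, rfl⟩ := Finset.mem_map.1 hc
          exact Finset.mem_filter.2 ⟨hmem a, rfl⟩
  calc (k : ℕ∞) ≤ (L.card : ℕ∞) := by exact_mod_cast hkL
    _ = (closedCell '' (L : Set (FaceLabel k R))).encard := by
      rw [(closedCell_injective hk).encard_image, encard_coe_eq_coe_finsetCard]
    _ ≤ G.encard := encard_le_encard (by
      rintro _ ⟨c, hc, rfl⟩
      exact (hL c).1 hc)

end FaceGuards

theorem theorem3 :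
    -- sufficiency
    (∀ (f : ℕ) (P : Set FaceGuards.E3),
      FaceGuards.IsPolyhedron P → FaceGuards.IsOriented 4 P →
      (FaceGuards.faces P).encard = (f : ℕ∞) →
      ∃ G : Set (Set FaceGuards.E3),
        FaceGuards.OpenFaceGuards P G ∧ G.encard ≤ ((f / 4 : ℕ) : ℕ∞)) ∧
    -- necessity
    (∀ f : ℕ, 4 ≤ f →
      ∃ P : Set FaceGuards.E3,
        FaceGuards.IsPolyhedron P ∧ FaceGuards.IsOriented 4 P ∧
        (FaceGuards.faces P).encard = (f : ℕ∞) ∧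
        ∀ G : Set (Set FaceGuards.E3),
          FaceGuards.OpenFaceGuards P G → ((f / 4 : ℕ) : ℕ∞) ≤ G.encard) := by
  refine ⟨fun f P hP hO hf => FaceGuards.exists_guards_of_four_oriented hP hO hf, fun f hf => ?_⟩
  -- as many pieces as guards, and one cut corner for each remaining face
  obtain ⟨R, -, hR⟩ := Finset.exists_subset_card_eq (s := (Finset.univ : Finset (Fin 3)))
    (n := f % 4) (by rw [Finset.card_univ, Fintype.card_fin]; omega)
  have hk : 0 < f / 4 := by omega
  refine ⟨FaceGuards.chain (f / 4) R, FaceGuards.isPolyhedron_chain hk R,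
    FaceGuards.isOriented_chain hk, ?_, fun G hG => FaceGuards.le_encard_of_guards_chain hk hG⟩
  rw [FaceGuards.encard_faces_chain hk, hR, Nat.div_add_mod]
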